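/- **Conventions.** Let $\mathcal H$ be a complex Hilbert space, $n\ge 0$, and let $X\subset\mathbb R^n$ be open. $\mathcal D'(X,\mathcal H)$ is the set of weakly continuous linear maps $C_0^\infty(X)\to\mathcal H$. $\mathcal E'(X,\mathcal H)$ is the set of those with compact support in $X$, identified with the linear maps $u$ on smooth functions for which there are a compact $K\subset X$, an $m\in\mathbb N_0$ and a $C>0$ with $\|u(f)\|\le C\sum_{|\alpha|\le m}\sup_{K}|\partial^\alpha f|$ for all smooth $f$; a sequence in $\mathcal E'(X,\mathcal H)$ is bounded if $K,m,C$ can be chosen the same for all its members. For $u\in\mathcal E'(X,\mathcal H)$ put $\hat u(k)=u(e^{-i\langle k,\cdot\rangle})$. The analytic wavefront set $\mathrm{WF}_A(\psi)$ of $\psi\in\mathcal D'(X,\mathcal H)$ is the complement in $X\times(\mathbb R^n\setminus\{0\})$ of the set of points $(x_0,k_0)$ for which there are an open neighbourhood $U\subset X$ of $x_0$, an open conic neighbourhood $\Gamma$ of $k_0$, a bounded sequence $(\psi_N)_{N\ge 0}$ in $\mathcal E'(X,\mathcal H)$ with $\psi_N=\psi$ in $U$ for every $N$, and a constant $C$ such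 that $|k|^N\|\hat\psi_N(k)\|\le C\,(C(N+1))^N$ for all $N$ and all $k\in\Gamma$. For functions $F(t,\cdot):X\to\mathcal H$ we say that $F(t,\cdot)\to\psi$ in the sense of distributions as $t\to0^+$ if for every $\varphi\in C_0^\infty(X)$ the vectors $\int_X\varphi(x)F(t,x)\,dx$ converge to $\psi(\varphi)$ weakly in $\mathcal H$ (in particular, if they converge in norm). Let $\psi\in\mathcal D'(X,\mathcal H)$. **Theorem.** Let $n\ge1$, $\epsilon>0$, $I=(0,\epsilon)$, and let $G:I\times X\to\mathcal H$ be a smooth function such that $G(t,\cdot)\to\psi$ in the sense of distributions as $t\to0^+$ and $\partial_tG=i\,\partial_{x_1}G$ on $I\times X$. Then $$\mathrm{WF}_A(\psi)\subset\{(x,y)\in X\times(\mathbb R^n\setminus\{0\}):\ y_1\ge0\}.$$ **Corollary.** Let $V\subset\mathbb R^n\setminus\{0\}$ be an open cone (an open set stable under multiplication by positive numbers), let $Z$ be an open neighbourhood of $0$ in $\mathbb R^n$, and let $G$ be an $\mathcal H$-valued (complex) analytic function on $X\times(V\cap Z)$, that is, on $\{x+iy:\ x\in X,\ y\in V\cap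 Z\}\subset\mathbb C^n$. Suppose that $\psi$ is the boundary value of $G$: for every $v\in V$, $G(\cdot+itv)\to\psi$ in the sense of distributions as $t\to0^+$ (in particular this holds if $G(\cdot+iy)\to\psi$ in the sense of distributions as $y\to 0$ in $V$). Then $$\mathrm{WF}_A(\psi)\subset X\times V^\circ,\qquad V^\circ=\{\xi\in\mathbb R^n:\ \langle v,\xi\rangle\ge0\ \text{for all } v\in V\}.$$ -/

import Mathlib

open Set Filter Topology TopologicalSpace MeasureTheory
open scoped ContDiff Distributions

/-- The Euclidean space `ℝⁿ`. -/
abbrev RSpace (n : ℕ) : Type := EuclideanSpace ℝ (Fin n)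

/-- `𝒟'(X, H)`: the weakly continuous `ℂ`-linear maps `C₀^∞(X) → H`, where `C₀^∞(X) = 𝓓(X, ℂ)`
carries its usual locally convex topology. -/
structure HilbertDistribution {n : ℕ} (X : Opens (RSpace n))
    (H : Type*) [NormedAddCommGroup H] [InnerProductSpace ℂ H] where
  toLinearMap : 𝓓(X, ℂ) →ₗ[ℂ] H
  weaklyContinuous : ∀ h : H, Continuous fun φ : 𝓓(X, ℂ) => inner ℂ h (toLinearMap φ)

/-- `C^∞(ℝⁿ)`: the smooth functions `ℝⁿ → ℂ`. -/
def SmoothFunctions (n : ℕ) : Submodule ℂ (RSpace n → ℂ) where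
  carrier := {f | ContDiff ℝ ∞ f}
  add_mem' hf hg := by
    rw [mem_ofPred_eq] at hf hg ⊢
    exact hf.add hg
  zero_mem' := by
    rw [mem_ofPred_eq]
    exact contDiff_const
  smul_mem' c f hf := by
    rw [mem_ofPred_eq] at hf ⊢
    exact contDiff_const.smul hf

/-- A test function, seen as a smooth function on `ℝⁿ`. -/
noncomputable def testToSmooth {n : ℕ} {X : Opens (RSpace n)} (φ : 𝓓(X, ℂ)) : SmoothFunctions n :=
  ⟨φ, φ.contDiff⟩

/-- The function `x ↦ exp (-i ⟨k, x⟩)`. -/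
noncomputable def planeWave {n : ℕ} (k : RSpace n) : SmoothFunctions n :=
  ⟨fun x => Complex.exp (-Complex.I * ((inner ℝ k x : ℝ) : ℂ)), by
    change ContDiff ℝ ∞ fun x : RSpace n => Complex.exp (-Complex.I * ((inner ℝ k x : ℝ) : ℂ))
    exact (contDiff_const.mul (Complex.ofRealCLM.contDiff.comp
      (contDiff_const.inner ℝ contDiff_id))).cexp⟩

/-- A sequence of distributions with compact support in `X`, bounded in `ℰ'(X, H)`.
The elements of `ℰ'(X, H)` are realised as linear maps on smooth functions whose norm is
controlled by finitely many derivatives on a compact set `K ⊆ X`; the sequence is bounded when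
`K`, the order `m` and the constant `C` serve all its members. The quantity `M` stands for any
bound of the derivatives of order at most `m` on `K`. -/
def IsBoundedSeqInE' {n : ℕ} {H : Type*} [NormedAddCommGroup H] [InnerProductSpace ℂ H]
    (X : Opens (RSpace n)) (u : ℕ → (SmoothFunctions n →ₗ[ℂ] H)) : Prop :=
  ∃ K : Set (RSpace n), IsCompact K ∧ K ⊆ X ∧ ∃ (m : ℕ) (C : ℝ), 0 < C ∧
    ∀ (N : ℕ) (f : SmoothFunctions n) (M : ℝ), 0 ≤ M →
      (∀ j ≤ m, ∀ x ∈ K, ‖iteratedFDeriv ℝ j (f : RSpace n → ℂ) x‖ ≤ M) → ‖u N f‖ ≤ C * M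

/-- An open cone: an open set that is stable under multiplication by positive numbers. -/
def IsOpenCone {n : ℕ} (Γ : Set (RSpace n)) : Prop :=
  IsOpen Γ ∧ ∀ c : ℝ, 0 < c → ∀ k ∈ Γ, c • k ∈ Γ

/-- Near `x₀` and in the directions near `k₀` the distribution `ψ` is analytically regular: there
are a neighbourhood `U ⊆ X` of `x₀`, a conic neighbourhood `Γ` of `k₀`, and a bounded sequence
`u N` of compactly supported distributions, equal to `ψ` in `U`, with
`|k|^N ‖û_N(k)‖ ≤ C (C (N + 1))^N` on `Γ`, where `û_N(k) = u_N(exp(-i⟨k, ·⟩))`. -/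
def IsAnalyticallyRegularAt {n : ℕ} {X : Opens (RSpace n)}
    {H : Type*} [NormedAddCommGroup H] [InnerProductSpace ℂ H]
    (ψ : HilbertDistribution X H) (x₀ k₀ : RSpace n) : Prop :=
  ∃ U : Set (RSpace n), IsOpen U ∧ U ⊆ X ∧ x₀ ∈ U ∧
  ∃ Γ : Set (RSpace n), IsOpenCone Γ ∧ k₀ ∈ Γ ∧
  ∃ u : ℕ → (SmoothFunctions n →ₗ[ℂ] H), IsBoundedSeqInE' X u ∧
    (∀ (N : ℕ) (φ : 𝓓(X, ℂ)), tsupport φ ⊆ U → u N (testToSmooth φ) = ψ.toLinearMap φ) ∧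
    ∃ C : ℝ, ∀ (N : ℕ), ∀ k ∈ Γ,
      ‖k‖ ^ N * ‖u N (planeWave k)‖ ≤ C * (C * ((N : ℝ) + 1)) ^ N

/-- The analytic wavefront set of `ψ`, a subset of `X × (ℝⁿ \ {0})`. -/
def analyticWF {n : ℕ} {X : Opens (RSpace n)}
    {H : Type*} [NormedAddCommGroup H] [InnerProductSpace ℂ H]
    (ψ : HilbertDistribution X H) : Set (RSpace n × RSpace n) :=
  {p | p.1 ∈ X ∧ p.2 ≠ 0 ∧ ¬ IsAnalyticallyRegularAt ψ p.1 p.2}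

/-- `F(t, ·) → ψ` as `t → 0+`, in the sense of distributions on `X`: for every test function `φ`
the vectors `∫ φ(x) F(t, x) dx` converge weakly in `H` to `ψ(φ)`. -/
def HasBoundaryValue {n : ℕ} {X : Opens (RSpace n)}
    {H : Type*} [NormedAddCommGroup H] [InnerProductSpace ℂ H]
    (F : ℝ → RSpace n → H) (ψ : HilbertDistribution X H) : Prop :=
  ∀ (φ : 𝓓(X, ℂ)) (h : H),
    Tendsto (fun t : ℝ => inner ℂ h (∫ x, φ x • F t x)) (𝓝[>] 0)
      (𝓝 (inner ℂ h (ψ.toLinearMap φ)))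

/-- The point `x + i y` of `ℂⁿ`. -/
def complexPoint {n : ℕ} (x y : RSpace n) : EuclideanSpace ℂ (Fin n) :=
  WithLp.toLp 2 fun j => (⟨x j, y j⟩ : ℂ)

/-- The subset `X + i W` of `ℂⁿ`. -/
def tubeSet {n : ℕ} (X W : Set (RSpace n)) : Set (EuclideanSpace ℂ (Fin n)) :=
  {z | ∃ x ∈ X, ∃ y ∈ W, z = complexPoint x y}

/-- The dual cone `{ξ | ⟨v, ξ⟩ ≥ 0 for all v ∈ V}`. -/
def dualCone {n : ℕ} (V : Set (RSpace n)) : Set (RSpace n) :=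
  {ξ | ∀ v ∈ V, 0 ≤ (inner ℝ v ξ : ℝ)}

/-! Fix a direction `v` with `∂ₜG = i ∂ᵥG` and a covector `k₀` with `⟨v, k₀⟩ < 0`; regularity at
`(x₀, k₀)` is the whole content (`isAnalyticallyRegularAt_of_inner_neg`). The theorem is the case `v
= e₁`; the corollary applies it to `G(x + itv)` for each `v ∈ V`, where the equation is the
Cauchy–Riemann equation along `v`.

Put `λ = -⟨v, k⟩`, which is at least `c|k|` on a cone around `k₀`. Pair `G(t, ·)` with `χ_j
e^{-i⟨k,·⟩}`, where `χ_j` is the `j`-th derivative along `v` of a cutoff `χ_0`. Integration by parts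
turns the equation into `g_j' = λ g_j - i g_{j+1}`. Hence `w_j = e^{-λt} (-i)^j g_j` satisfies `w_j'
= w_{j+1}`, and Taylor expansion from `t = δ` back to `t = 0` writes the transform of `χ_0 ψ` at `k`
as terms carrying `e^{-λδ}` plus a remainder of size `‖g_{M+1}‖ λ^{-(M+1)}`, up to powers of a
constant (`norm_weakLimit_le_of_chain`). This replaces a shift of contour, with a cutoff that is not
analytic.

Two inputs make the bounds usable. The cutoff depends on `N`, and its first `N` derivatives along
`v` cost only `(D(N + 1))^j` (`exists_cutoffs_along`). By the uniform boundedness principle, the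
existence of the boundary value alone forces the `G(t, ·)`, for `0 < t ≤ δ`, to have one common
finite order on compact sets (`HasBoundaryValue.exists_uniform_order`). With `M` about `N`,
`exists_gevrey_bound` gives the factorial growth that defines `analyticWF`. -/

/-! ### Cutoff functions with analytic-type bounds on finitely many derivatives. -/

/-- The mean of `f` over the interval of radius `h` around `x`. -/
noncomputable def intervalMean (h : ℝ) (f : ℝ → ℂ) (x : ℝ) : ℂ :=
  (2 * h)⁻¹ • ∫ t in (x - h)..(x + h), f t

theorem hasDerivAt_intervalMean (h : ℝ) {f : ℝ → ℂ} (hf : Continuous f) (x : ℝ) :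
    HasDerivAt (intervalMean h f) ((2 * h)⁻¹ • (f (x + h) - f (x - h))) x := by
  have key : ∀ y, intervalMean h f y
      = (2 * h)⁻¹ • ((∫ t in (0 : ℝ)..(y + h), f t) - ∫ t in (0 : ℝ)..(y - h), f t) := by
    intro y
    rw [intervalIntegral.integral_interval_sub_left (hf.intervalIntegrable _ _)
      (hf.intervalIntegrable _ _)]
    rfl
  rw [show intervalMean h f = _ from funext key]
  have d : ∀ y, HasDerivAt (fun u => ∫ t in (0 : ℝ)..u, f t) (f y) y := fun y =>
    intervalIntegral.integral_hasDerivAt_right (hf.intervalIntegrable _ _)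
      (hf.stronglyMeasurableAtFilter _ _) hf.continuousAt
  exact (((d (x + h)).comp_add_const x h).fun_sub
    ((d (x - h)).comp_sub_const x h)).fun_const_smul _

theorem intervalMean_deriv (h : ℝ) {f : ℝ → ℂ} (hf : ContDiff ℝ ∞ f) (x : ℝ) :
    intervalMean h (deriv f) x = (2 * h)⁻¹ • (f (x + h) - f (x - h)) := by
  rw [intervalMean, intervalIntegral.integral_deriv_eq_sub]
  · exact fun y _ => hf.differentiable (by simp) y
  · exact (hf.continuous_deriv (by simp)).intervalIntegrable _ _

theorem contDiff_iteratedDeriv_infty {f : ℝ → ℂ} (hf : ContDiff ℝ ∞ f) (i : ℕ) :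
    ContDiff ℝ ∞ (iteratedDeriv i f) := by
  rw [iteratedDeriv_eq_iterate]
  exact hf.iterate_deriv i

theorem iteratedDeriv_intervalMean (h : ℝ) {f : ℝ → ℂ} (hf : ContDiff ℝ ∞ f) (i : ℕ) :
    iteratedDeriv i (intervalMean h f) = intervalMean h (iteratedDeriv i f) := by
  induction i with
  | zero => simp
  | succ i ih =>
    have hc := contDiff_iteratedDeriv_infty hf i
    rw [iteratedDeriv_succ, ih, iteratedDeriv_succ]
    funext x
    rw [(hasDerivAt_intervalMean h hc.continuous x).deriv, intervalMean_deriv h hc]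

theorem contDiff_intervalMean (h : ℝ) {f : ℝ → ℂ} (hf : ContDiff ℝ ∞ f) :
    ContDiff ℝ ∞ (intervalMean h f) := by
  refine contDiff_of_differentiable_iteratedDeriv fun m _ => ?_
  rw [iteratedDeriv_intervalMean h hf]
  exact fun x => (hasDerivAt_intervalMean h
    (contDiff_iteratedDeriv_infty hf m).continuous x).differentiableAt

theorem norm_intervalMean_le {h : ℝ} (hh : 0 < h) {f : ℝ → ℂ} {B : ℝ} (hB : ∀ x, ‖f x‖ ≤ B)
    (x : ℝ) : ‖intervalMean h f x‖ ≤ B := by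
  have H := intervalIntegral.norm_integral_le_of_norm_le_const (a := x - h) (b := x + h)
    (f := f) (C := B) fun y _ => hB y
  rw [intervalMean, norm_smul, norm_inv, Real.norm_of_nonneg (by positivity : 0 ≤ 2 * h),
    inv_mul_le_iff₀ (by positivity)]
  rwa [show x + h - (x - h) = 2 * h by ring, abs_of_pos (by positivity), mul_comm] at H

theorem intervalMean_eq_const {h : ℝ} (hh : 0 < h) {f : ℝ → ℂ} {c : ℂ} {x : ℝ}
    (hc : ∀ t, |t - x| ≤ h → f t = c) : intervalMean h f x = c := by
  have : ∫ t in (x - h)..(x + h), f t = ∫ t in (x - h)..(x + h), c := by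
    refine intervalIntegral.integral_congr fun t ht => hc t ?_
    rw [uIcc_of_le (by linarith), mem_Icc] at ht
    rw [abs_le]
    constructor <;> linarith [ht.1, ht.2]
  rw [intervalMean, this, intervalIntegral.integral_const, smul_smul,
    show (2 * h)⁻¹ * (x + h - (x - h)) = 1 by field_simp; ring, one_smul]

/-- Averaging a fixed bump `N` times over intervals of radius `h` lets each average absorb one
derivative at the price `h⁻¹`, while the remaining `l` derivatives fall on the bump. Thus `B`
depends on neither `h` nor `N`. -/
theorem exists_cutoff_real {r : ℝ} (hr : 0 < r) : ∃ B : ℕ → ℝ, (∀ l, 0 ≤ B l) ∧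
    ∀ (h : ℝ) (N : ℕ), 0 < h → N * h ≤ r → ∃ a : ℝ → ℂ, ContDiff ℝ ∞ a ∧
      (∀ x, |x| ≤ r → a x = 1) ∧ (∀ x, 4 * r ≤ |x| → a x = 0) ∧
      ∀ l j x, j ≤ N → ‖iteratedDeriv (l + j) a x‖ ≤ B l * h⁻¹ ^ j := by
  let g : ContDiffBump (0 : ℝ) := ⟨2 * r, 3 * r, by linarith, by linarith⟩
  let f : ℝ → ℂ := fun x => ((g x : ℝ) : ℂ)
  have hf : ContDiff ℝ ∞ f := Complex.ofRealCLM.contDiff.comp g.contDiff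
  have hfc : HasCompactSupport f := g.hasCompactSupport.comp_left (g := fun y : ℝ => (y : ℂ)) (by simp)
  have hfs : ∀ l, HasCompactSupport (iteratedDeriv l f) := fun l => by
    induction l with
    | zero => simpa using hfc
    | succ l ih => rw [iteratedDeriv_succ]; exact ih.deriv
  have hb : ∀ l, ∃ B, ∀ x, ‖iteratedDeriv l f x‖ ≤ B := fun l =>
    (hfs l).exists_bound_of_continuous
      (contDiff_iteratedDeriv_infty hf l).continuous
  choose B hB using hb
  refine ⟨B, fun l => (norm_nonneg _).trans (hB l 0), ?_⟩
  intro h N hh hN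
  -- Each average erodes the plateau and enlarges the support by `h`; the induction tracks this, and
  -- `N * h ≤ r` is needed only at the end.
  suffices H : ∀ N : ℕ, ∃ a : ℝ → ℂ, ContDiff ℝ ∞ a ∧
      (∀ x, |x| ≤ 2 * r - N * h → a x = 1) ∧ (∀ x, 3 * r + N * h ≤ |x| → a x = 0) ∧
      ∀ l j x, j ≤ N → ‖iteratedDeriv (l + j) a x‖ ≤ B l * h⁻¹ ^ j by
    obtain ⟨a, h1, h2, h3, h4⟩ := H N
    exact ⟨a, h1, fun x hx => h2 x (by linarith), fun x hx => h3 x (by linarith), h4⟩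
  clear hN N
  intro N
  induction N with
  | zero =>
    refine ⟨f, hf, fun x hx => ?_, fun x hx => ?_, fun l j x hj => ?_⟩
    · have : g x = 1 := g.one_of_mem_closedBall (by simpa [g] using hx)
      simp [f, this]
    · have : g x = 0 := g.zero_of_le_dist (by simpa [g] using hx)
      simp [f, this]
    · obtain rfl : j = 0 := by omega
      simpa using hB l x
  | succ N ih =>
    obtain ⟨a, h1, h2, h3, h4⟩ := ih
    refine ⟨intervalMean h a, contDiff_intervalMean h h1, fun x hx => ?_, fun x hx => ?_,
      fun l j x hj => ?_⟩
    · refine intervalMean_eq_const hh fun t ht => h2 t ?_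
      push_cast at hx
      have := abs_sub_abs_le_abs_sub t x
      linarith
    · refine intervalMean_eq_const hh fun t ht => h3 t ?_
      push_cast at hx
      have := abs_sub_abs_le_abs_sub x t
      rw [abs_sub_comm] at this
      linarith
    · rcases Nat.lt_or_ge N j with hjN | hjN
      -- The newly allowed derivative becomes a difference quotient of step `2h`, bounded by twice
      -- the old bound divided by `2h`.
      · obtain rfl : j = N + 1 := by omega
        have hc := contDiff_iteratedDeriv_infty h1 (l + N)
        rw [← add_assoc, iteratedDeriv_succ, iteratedDeriv_intervalMean h h1,
          (hasDerivAt_intervalMean h hc.continuous x).deriv, norm_smul, norm_inv,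
          Real.norm_of_nonneg (by positivity : 0 ≤ 2 * h)]
        have e1 := h4 l N (x + h) le_rfl
        have e2 := h4 l N (x - h) le_rfl
        have e3 := norm_sub_le (iteratedDeriv (l + N) a (x + h)) (iteratedDeriv (l + N) a (x - h))
        calc _ ≤ (2 * h)⁻¹ * (B l * h⁻¹ ^ N + B l * h⁻¹ ^ N) := by gcongr; linarith
          _ = _ := by rw [pow_succ, mul_inv]; ring
      · rw [iteratedDeriv_intervalMean h h1]
        exact norm_intervalMean_le hh (fun y => h4 l j y hjN) x

theorem norm_iteratedFDeriv_mul_le_two_pow {E : Type*} [NormedAddCommGroup E] [NormedSpace ℝ E]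
    {f g : E → ℂ} (hf : ContDiff ℝ ∞ f) (hg : ContDiff ℝ ∞ g) {x : E} {m : ℕ} {A B : ℝ}
    (hA : ∀ i ≤ m, ‖iteratedFDeriv ℝ i f x‖ ≤ A) (hB : ∀ i ≤ m, ‖iteratedFDeriv ℝ i g x‖ ≤ B)
    {i : ℕ} (hi : i ≤ m) :
    ‖iteratedFDeriv ℝ i (fun y => f y * g y) x‖ ≤ 2 ^ m * (A * B) := by
  have hA0 : 0 ≤ A := (norm_nonneg _).trans (hA 0 (Nat.zero_le _))
  have hB0 : 0 ≤ B := (norm_nonneg _).trans (hB 0 (Nat.zero_le _))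
  calc _ ≤ _ := norm_iteratedFDeriv_mul_le hf hg x (n := i) (by exact_mod_cast le_top)
    _ ≤ ∑ p ∈ Finset.range (i + 1), (i.choose p : ℝ) * (A * B) := by
      refine Finset.sum_le_sum fun p hp => ?_
      rw [Finset.mem_range] at hp
      rw [mul_assoc]
      gcongr
      · exact hA p (by omega)
      · exact hB (i - p) (by omega)
    _ = 2 ^ i * (A * B) := by
      rw [← Finset.sum_mul]
      congr 1
      exact_mod_cast Nat.sum_range_choose i
    _ ≤ _ := by
      gcongr
      norm_num

theorem norm_iteratedFDeriv_comp_affine_le {E F : Type*} [NormedAddCommGroup E] [NormedSpace ℝ E]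
    [NormedAddCommGroup F] [NormedSpace ℝ F] (g : E →L[ℝ] F) {f : F → ℂ} (hf : ContDiff ℝ ∞ f)
    (x₀ x : E) (i : ℕ) {B : ℝ} (hB : ∀ y, ‖iteratedFDeriv ℝ i f y‖ ≤ B) :
    ‖iteratedFDeriv ℝ i (fun y => f (g (y - x₀))) x‖ ≤ B * ‖g‖ ^ i := by
  have h1 : iteratedFDeriv ℝ i (fun y => f (g (y - x₀))) x
      = iteratedFDeriv ℝ i (f ∘ g) (x - x₀) := by
    rw [← iteratedFDeriv_comp_sub]
    rfl
  rw [h1]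
  rw [g.iteratedFDeriv_comp_right hf _ (by exact_mod_cast le_top)]
  refine (ContinuousMultilinearMap.norm_compContinuousLinearMap_le _ _).trans ?_
  rw [Finset.prod_const, Finset.card_univ, Fintype.card_fin]
  gcongr
  exact hB _

theorem iteratedDeriv_add_apply (f : ℝ → ℂ) (i j : ℕ) :
    iteratedDeriv i (iteratedDeriv j f) = iteratedDeriv (i + j) f := by
  simp only [iteratedDeriv_eq_iterate, Function.iterate_add_apply]

/-- Cutoff functions near `x₀` whose first `N` derivatives in the direction `v` grow like those of
an analytic function. -/
theorem exists_cutoffs_along {n : ℕ} (X : Opens (RSpace n)) {x₀ v : RSpace n} (hx₀ : x₀ ∈ X)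
    (hv : v ≠ 0) :
    ∃ K : Set (RSpace n), IsCompact K ∧ K ⊆ X ∧ ∃ U : Set (RSpace n), IsOpen U ∧ U ⊆ X ∧ x₀ ∈ U ∧
    ∃ (A : ℕ → ℝ) (D : ℝ), (∀ m, 0 ≤ A m) ∧ 0 < D ∧ ∀ N : ℕ, ∃ χ : ℕ → RSpace n → ℂ,
      (∀ j, ContDiff ℝ ∞ (χ j)) ∧ (∀ j, tsupport (χ j) ⊆ K) ∧ (∀ x ∈ U, χ 0 x = 1) ∧
      (∀ j x, HasLineDerivAt ℝ (χ j) (χ (j + 1) x) x v) ∧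
      ∀ m j i x, j ≤ N → i ≤ m → ‖iteratedFDeriv ℝ i (χ j) x‖ ≤ A m * (D * (N + 1)) ^ j := by
  obtain ⟨R, hR, hRX⟩ := Metric.nhds_basis_closedBall.mem_iff.1 (X.isOpen.mem_nhds hx₀)
  have hv' : 0 < ‖v‖ := norm_pos_iff.2 hv
  let l : RSpace n →L[ℝ] ℝ := (‖v‖ ^ 2)⁻¹ • innerSL ℝ v
  have hlv : l v = 1 := by
    change (‖v‖ ^ 2)⁻¹ * inner ℝ v v = 1
    rw [real_inner_self_eq_norm_sq]
    field_simp
  -- `P` projects along `v` onto the kernel of `l`. A product of a function of `l` and a function of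
  -- `P` is differentiated along `v` in its first factor only.
  let P : RSpace n →L[ℝ] RSpace n := ContinuousLinearMap.id ℝ _ - l.smulRight v
  have hP : ∀ y, P y = y - l y • v := fun y => by simp [P]
  have hPv : P v = 0 := by rw [hP, hlv, one_smul, sub_self]
  obtain ⟨r, hr, hrR⟩ : ∃ r > 0, 4 * r * ‖v‖ = R / 2 := ⟨R / (8 * ‖v‖), by positivity, by
    field_simp; norm_num⟩
  have hdist : ∀ x, |l (x - x₀)| ≤ 4 * r → ‖P (x - x₀)‖ ≤ R / 2 →
      x ∈ Metric.closedBall x₀ R := by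
    intro x h1 h2
    rw [mem_closedBall_iff_norm, show x - x₀ = P (x - x₀) + l (x - x₀) • v by rw [hP]; abel]
    refine (norm_add_le _ _).trans ?_
    rw [norm_smul, Real.norm_eq_abs]
    nlinarith
  let g : ContDiffBump (0 : RSpace n) := ⟨R / 4, R / 2, by linarith, by linarith⟩
  let b : RSpace n → ℂ := fun x => ((g x : ℝ) : ℂ)
  have hb : ContDiff ℝ ∞ b := Complex.ofRealCLM.contDiff.comp g.contDiff
  have hbc : HasCompactSupport b :=
    g.hasCompactSupport.comp_left (g := fun y : ℝ => (y : ℂ)) (by simp)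
  have hbb : ∀ i, ∃ B, ∀ x, ‖iteratedFDeriv ℝ i b x‖ ≤ B := fun i =>
    (hbc.iteratedFDeriv i).exists_bound_of_continuous
      (hb.continuous_iteratedFDeriv (by exact_mod_cast le_top))
  choose B₂ hB₂ using hbb
  have hB₂0 : ∀ i, 0 ≤ B₂ i := fun i => (norm_nonneg _).trans (hB₂ i 0)
  obtain ⟨B₁, hB₁0, hB₁⟩ := exists_cutoff_real hr
  let A₁ : ℕ → ℝ := fun m => ∑ i ∈ Finset.range (m + 1), B₁ i * ‖l‖ ^ i
  let A₂ : ℕ → ℝ := fun m => ∑ i ∈ Finset.range (m + 1), B₂ i * ‖P‖ ^ i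
  have hA₁0 : ∀ m, 0 ≤ A₁ m := fun m => Finset.sum_nonneg fun i _ =>
    mul_nonneg (hB₁0 i) (by positivity)
  have hA₂0 : ∀ m, 0 ≤ A₂ m := fun m => Finset.sum_nonneg fun i _ =>
    mul_nonneg (hB₂0 i) (by positivity)
  have hA₁ : ∀ m, ∀ i ≤ m, B₁ i * ‖l‖ ^ i ≤ A₁ m := fun m i hi =>
    Finset.single_le_sum (f := fun i => B₁ i * ‖l‖ ^ i)
      (fun i _ => mul_nonneg (hB₁0 i) (by positivity)) (Finset.mem_range.2 (by omega))
  have hA₂ : ∀ m, ∀ i ≤ m, B₂ i * ‖P‖ ^ i ≤ A₂ m := fun m i hi =>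
    Finset.single_le_sum (f := fun i => B₂ i * ‖P‖ ^ i)
      (fun i _ => mul_nonneg (hB₂0 i) (by positivity)) (Finset.mem_range.2 (by omega))
  refine ⟨Metric.closedBall x₀ R, isCompact_closedBall _ _, hRX,
    {x | |l (x - x₀)| < r ∧ ‖P (x - x₀)‖ < R / 4}, ?_, ?_, ?_, fun m => 2 ^ m * (A₁ m * A₂ m), r⁻¹,
    fun m => mul_nonneg (by positivity) (mul_nonneg (hA₁0 m) (hA₂0 m)), by positivity, ?_⟩
  · exact (isOpen_lt (by fun_prop : Continuous fun x => |l (x - x₀)|) continuous_const).inter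
      (isOpen_lt (by fun_prop : Continuous fun x => ‖P (x - x₀)‖) continuous_const)
  · rintro x ⟨h1, h2⟩
    exact hRX (hdist x (by linarith) (by linarith))
  · simp only [mem_ofPred_eq, sub_self, map_zero, abs_zero, norm_zero]
    exact ⟨hr, by positivity⟩
  intro N
  -- With `h = r / (N + 1)` the cost `h⁻¹` of a derivative is `r⁻¹ * (N + 1)`, whence `D = r⁻¹`.
  obtain ⟨a, ha, ha1, ha0, hab⟩ := hB₁ (r / (N + 1)) N (by positivity) (by
    rw [mul_div_assoc', div_le_iff₀ (by positivity)]
    nlinarith)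
  have haj : ∀ j, ContDiff ℝ ∞ (iteratedDeriv j a) := contDiff_iteratedDeriv_infty ha
  have hasupp : ∀ j y, iteratedDeriv j a y ≠ 0 → |y| ≤ 4 * r := by
    intro j y hy
    have h1 : y ∈ tsupport a := by
      refine support_iteratedFDeriv_subset (𝕜 := ℝ) j ?_
      rw [Function.mem_support, ← norm_ne_zero_iff, norm_iteratedFDeriv_eq_norm_iteratedDeriv]
      exact norm_ne_zero_iff.2 hy
    have h2 : tsupport a ⊆ {y | |y| ≤ 4 * r} := by
      refine closure_minimal (fun z hz => ?_) (isClosed_le continuous_abs continuous_const)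
      by_contra hcon
      exact hz (ha0 z (not_le.1 hcon).le)
    exact h2 h1
  have c1 : ∀ j, ContDiff ℝ ∞ fun x => iteratedDeriv j a (l (x - x₀)) := fun j =>
    (haj j).comp (l.contDiff.comp (contDiff_id.sub contDiff_const))
  have c2 : ContDiff ℝ ∞ fun x => b (P (x - x₀)) :=
    hb.comp (P.contDiff.comp (contDiff_id.sub contDiff_const))
  refine ⟨fun j x => iteratedDeriv j a (l (x - x₀)) * b (P (x - x₀)), fun j => (c1 j).mul c2,
    fun j => ?_, ?_, fun j x => ?_, fun m j i x hj hi => ?_⟩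
  · refine closure_minimal (fun x hx => ?_) Metric.isClosed_closedBall
    have h1 := left_ne_zero_of_mul hx
    have h2 := right_ne_zero_of_mul hx
    refine hdist x (hasupp j _ h1) ?_
    by_contra hcon
    refine h2 ?_
    have : g (P (x - x₀)) = 0 := g.zero_of_le_dist (by
      rw [dist_zero_right]
      exact (not_le.1 hcon).le)
    simp only [b, this, Complex.ofReal_zero]
  · rintro x ⟨h1, h2⟩
    have : g (P (x - x₀)) = 1 := g.one_of_mem_closedBall (by
      rw [mem_closedBall_zero_iff]
      exact h2.le)
    simp only [b, this, iteratedDeriv_zero, ha1 _ h1.le, Complex.ofReal_one, mul_one]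
  · have h1 : HasDerivAt (iteratedDeriv j a) (iteratedDeriv (j + 1) a (l (x - x₀)))
        (l (x - x₀) + 0) := by
      rw [add_zero, iteratedDeriv_succ]
      exact ((haj j).differentiable (by simp) _).hasDerivAt
    have h2 := (h1.comp_const_add (l (x - x₀)) 0).mul_const (b (P (x - x₀)))
    refine HasDerivAt.congr_of_eventuallyEq h2 (Eventually.of_forall fun t => ?_)
    have e : x + t • v - x₀ = x - x₀ + t • v := by abel
    simp only [e, map_add, map_smul, hlv, hPv, smul_eq_mul, mul_one, smul_zero, add_zero]
  · have e1 : ∀ i ≤ m, ‖iteratedFDeriv ℝ i (fun x => iteratedDeriv j a (l (x - x₀))) x‖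
        ≤ A₁ m * (r⁻¹ * (N + 1)) ^ j := by
      intro i hi
      refine (norm_iteratedFDeriv_comp_affine_le l (haj j) x₀ x i
        (B := B₁ i * (r⁻¹ * (N + 1)) ^ j) fun y => ?_).trans ?_
      · rw [norm_iteratedFDeriv_eq_norm_iteratedDeriv, iteratedDeriv_add_apply]
        refine (hab i j y hj).trans_eq ?_
        rw [inv_div, inv_mul_eq_div]
      · rw [mul_right_comm]
        gcongr
        exact hA₁ m i hi
    have e2 : ∀ i ≤ m, ‖iteratedFDeriv ℝ i (fun x => b (P (x - x₀))) x‖ ≤ A₂ m := fun i hi =>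
      (norm_iteratedFDeriv_comp_affine_le P hb x₀ x i (hB₂ i)).trans (hA₂ m i hi)
    refine (norm_iteratedFDeriv_mul_le_two_pow (c1 j) c2 e1 e2 hi).trans_eq ?_
    ring

/-! ### Uniform order of the family `G(t, ·)` near `t = 0`. -/

section UniformBound

variable {n : ℕ} {H : Type*} [NormedAddCommGroup H] [InnerProductSpace ℂ H]

theorem integrable_smul_of_tsupport_subset {K : Set (RSpace n)} (hK : IsCompact K)
    {φ : RSpace n → ℂ} (hφ : Continuous φ) (hφK : tsupport φ ⊆ K) {g : RSpace n → H}
    (hg : ContinuousOn g K) : Integrable fun x => φ x • g x := by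
  rw [← integrableOn_iff_integrable_of_support_subset (s := K)]
  · exact (hφ.continuousOn.smul hg).integrableOn_compact hK
  · intro x hx
    exact hφK (subset_tsupport _ (left_ne_zero_of_smul hx))

theorem iteratedFDeriv_eq_zero_of_notMem {K : Set (RSpace n)} {φ : RSpace n → ℂ}
    (hφK : tsupport φ ⊆ K) (j : ℕ) {x : RSpace n} (hx : x ∉ K) : iteratedFDeriv ℝ j φ x = 0 := by
  by_contra h
  exact hx (hφK (support_iteratedFDeriv_subset j h))

/-- A pointwise bounded family of functionals `φ ↦ ∫ φ • g i` on the smooth functions supported in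
a compact set is equicontinuous. -/
theorem exists_uniform_order_of_pointwise_bounded {ι : Type*} {K : Set (RSpace n)}
    (hK : IsCompact K) (g : ι → RSpace n → H) (hg : ∀ i, ContinuousOn (g i) K)
    (hb : ∀ φ : RSpace n → ℂ, ContDiff ℝ ∞ φ → tsupport φ ⊆ K →
      ∃ C, ∀ i, ‖∫ x, φ x • g i x‖ ≤ C) :
    ∃ (m : ℕ) (C : ℝ), 0 < C ∧ ∀ i (φ : RSpace n → ℂ) (M : ℝ), ContDiff ℝ ∞ φ → tsupport φ ⊆ K →
      0 ≤ M → (∀ j ≤ m, ∀ x ∈ K, ‖iteratedFDeriv ℝ j φ x‖ ≤ M) → ‖∫ x, φ x • g i x‖ ≤ C * M := by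
  by_contra! hcon
  have hcon' : ∀ m : ℕ, ∃ (i : ι) (f : RSpace n → ℂ), ContDiff ℝ ∞ f ∧ tsupport f ⊆ K ∧
      (∀ j ≤ m, ∀ x, ‖iteratedFDeriv ℝ j f x‖ ≤ (1 / 2) ^ m) ∧
      (m : ℝ) ≤ ‖∫ x, f x • g i x‖ := by
    intro m
    -- Dividing the counterexample by `M * 2 ^ m` makes its derivatives of order at most `m` smaller
    -- than or equal to `2⁻ᵐ` while the pairing stays above `m`.
    obtain ⟨i, φ, M, hφ, hφK, hM, hd, hlt⟩ := hcon m ((m + 1) * 2 ^ m) (by positivity)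
    have hMpos : 0 < M := by
      refine hM.lt_of_ne' fun h0 => ?_
      have hz : ∀ x, φ x = 0 := by
        intro x
        by_cases hx : x ∈ K
        · have := hd 0 (Nat.zero_le _) x hx
          rw [norm_iteratedFDeriv_zero, h0] at this
          exact norm_le_zero_iff.1 this
        · exact image_eq_zero_of_notMem_tsupport fun h => hx (hφK h)
      simp [hz, h0] at hlt
    set c : ℝ := (M * 2 ^ m)⁻¹ with hc
    have hcpos : 0 < c := by positivity
    refine ⟨i, fun x => c • φ x, hφ.const_smul c, (tsupport_smul_subset_right _ _).trans hφK,
      fun j hj x => ?_, ?_⟩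
    · have e : iteratedFDeriv ℝ j (fun x => c • φ x) x = c • iteratedFDeriv ℝ j φ x :=
        iteratedFDeriv_const_smul_apply' (hφ.of_le (by exact_mod_cast le_top)).contDiffAt
      rw [e, norm_smul, Real.norm_of_nonneg hcpos.le]
      have h1 : ‖iteratedFDeriv ℝ j φ x‖ ≤ M := by
        by_cases hx : x ∈ K
        · exact hd j hj x hx
        · rw [iteratedFDeriv_eq_zero_of_notMem hφK j hx, norm_zero]
          exact hM
      calc c * _ ≤ c * M := by gcongr
        _ = (1 / 2) ^ m := by rw [hc, one_div, inv_pow]; field_simp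
    · have e : ∫ x, (c • φ x) • g i x = c • ∫ x, φ x • g i x := by
        rw [← integral_smul]
        simp only [smul_assoc]
      rw [e, norm_smul, Real.norm_of_nonneg hcpos.le]
      calc (m : ℝ) ≤ c * ((m + 1) * 2 ^ m * M) := by rw [hc]; field_simp; linarith
        _ ≤ _ := by gcongr
  choose i f hf hfK hfd hfm using hcon'
  have hf0 : ∀ m x, ‖f m x‖ ≤ (1 / 2 : ℝ) ^ m := fun m x => by
    simpa using hfd m 0 (Nat.zero_le _) x
  have hgeo : ∀ B : ℝ, Summable fun m : ℕ => B * (1 / 2 : ℝ) ^ m := fun B =>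
    (summable_geometric_of_lt_one (by norm_num) (by norm_num)).mul_left B
  have hbd : ∀ (c : BoundedContinuousFunction ℕ ℂ) m x, ‖c m * f m x‖ ≤ ‖c‖ * (1 / 2) ^ m :=
    fun c m x => by
      rw [norm_mul]
      exact mul_le_mul (c.norm_coe_le_norm m) (hf0 m x) (norm_nonneg _) (norm_nonneg _)
  have hsum : ∀ (c : BoundedContinuousFunction ℕ ℂ) x, Summable fun m => c m * f m x :=
    fun c x => Summable.of_norm_bounded (hgeo ‖c‖) fun m => hbd c m x
  -- Superposing the counterexamples with bounded coefficients gives test functions supported in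
  -- `K`. This moves the problem to the Banach space of bounded sequences, so that Banach–Steinhaus
  -- applies without the Fréchet topology of test functions.
  let F : BoundedContinuousFunction ℕ ℂ → RSpace n → ℂ := fun c x => ∑' m, c m * f m x
  have hF : ∀ c, ContDiff ℝ ∞ (F c) := by
    intro c
    refine contDiff_tsum_of_eventually (N := ⊤) (v := fun _ m => ‖c‖ * (1 / 2) ^ m)
      (fun m => contDiff_const.mul (hf m)) (fun k _ => hgeo ‖c‖) fun k _ => ?_
    rw [Nat.cofinite_eq_atTop]
    -- The `k`-th derivative of `f m` is controlled only for `m ≥ k`, which suffices for summation.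
    filter_upwards [eventually_ge_atTop k] with m hm x
    have e : iteratedFDeriv ℝ k (fun x => c m • f m x) x = c m • iteratedFDeriv ℝ k (f m) x :=
      iteratedFDeriv_const_smul_apply' ((hf m).of_le (by exact_mod_cast le_top)).contDiffAt
    simp only [← smul_eq_mul]
    rw [e, norm_smul]
    exact mul_le_mul (c.norm_coe_le_norm m) (hfd m k hm x) (norm_nonneg _) (norm_nonneg _)
  have hFK : ∀ c, tsupport (F c) ⊆ K := by
    refine fun c => closure_minimal (fun x hx => ?_) hK.isClosed
    by_contra hxK
    refine hx ?_
    have : ∀ m, f m x = 0 := fun m =>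
      image_eq_zero_of_notMem_tsupport fun h => hxK (hfK m h)
    simp [F, this]
  have hFn : ∀ c x, ‖F c x‖ ≤ 2 * ‖c‖ := fun c x => by
    refine (tsum_of_norm_bounded (((hasSum_geometric_two).mul_left ‖c‖)) fun m => hbd c m x).trans_eq
      (mul_comm _ _)
  have hgi : ∀ i, IntegrableOn (fun x => ‖g i x‖) K := fun i => (hg i).norm.integrableOn_compact hK
  have hFi : ∀ c i, Integrable fun x => F c x • g i x := fun c i =>
    integrable_smul_of_tsupport_subset hK (hF c).continuous (hFK c) (hg i)
  let T : ι → BoundedContinuousFunction ℕ ℂ →L[ℂ] H := fun i =>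
    LinearMap.mkContinuous
      { toFun := fun c => ∫ x, F c x • g i x
        map_add' := fun c d => by
          rw [← integral_add (hFi c i) (hFi d i)]
          congr 1
          funext x
          rw [← add_smul]
          congr 1
          simp only [F, BoundedContinuousFunction.add_apply, add_mul]
          exact (hsum c x).tsum_add (hsum d x)
        map_smul' := fun a c => by
          rw [RingHom.id_apply, ← integral_smul]
          congr 1
          funext x
          rw [smul_smul]
          congr 1
          simp only [F, BoundedContinuousFunction.smul_apply, smul_eq_mul, mul_assoc]
          exact tsum_mul_left }
      (2 * ∫ x in K, ‖g i x‖) (fun c => by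
        change ‖∫ x, F c x • g i x‖ ≤ _
        rw [← setIntegral_eq_integral_of_forall_compl_eq_zero (s := K)]
        · calc _ ≤ ∫ x in K, 2 * ‖c‖ * ‖g i x‖ := by
                refine norm_integral_le_of_norm_le ((hgi i).const_mul _)
                  (Eventually.of_forall fun x => ?_)
                rw [norm_smul]
                gcongr
                exact hFn c x
            _ = _ := by rw [integral_const_mul]; ring
        · intro x hx
          rw [image_eq_zero_of_notMem_tsupport fun h => hx (hFK c h), zero_smul])
  obtain ⟨C, hC⟩ := banach_steinhaus (g := T) fun c => hb (F c) (hF c) (hFK c)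
  obtain ⟨m, hm⟩ := exists_nat_gt C
  -- The `m`-th unit sequence recovers `f m`, whose pairing is at least `m > C`.
  let e : BoundedContinuousFunction ℕ ℂ :=
    BoundedContinuousFunction.ofNormedAddCommGroupDiscrete (Pi.single m 1) 1 fun k => by
      by_cases hk : k = m
      · subst hk; simp
      · simp [hk]
  have he : ‖e‖ ≤ 1 := BoundedContinuousFunction.norm_ofNormedAddCommGroup_le _ zero_le_one _
  have hFe : F e = f m := by
    funext x
    refine (tsum_eq_single m fun k hk => ?_).trans ?_
    · simp [e, hk]
    · simp [e]
  have h1 : (m : ℝ) ≤ ‖T (i m) e‖ := by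
    change (m : ℝ) ≤ ‖∫ x, F e x • g (i m) x‖
    rw [hFe]
    exact hfm m
  have h2 := (T (i m)).le_opNorm e
  have h3 : ‖T (i m)‖ * ‖e‖ ≤ C * 1 :=
    mul_le_mul (hC _) he (norm_nonneg _) ((norm_nonneg _).trans (hC (i m)))
  linarith

/-- Weakly bounded families in a Hilbert space are norm bounded. Against a fixed `h`, the limit
controls small `t`; compactness of `[η, δ] × K` controls the rest, which is why `δ < ε`. -/
theorem pointwise_bounded_of_hasBoundaryValue [CompleteSpace H] {X : Opens (RSpace n)}
    {ψ : HilbertDistribution X H} {ε δ : ℝ} {G : ℝ → RSpace n → H}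
    (hG : ContinuousOn (fun p : ℝ × RSpace n => G p.1 p.2) (Ioo 0 ε ×ˢ (X : Set (RSpace n))))
    (hψ : HasBoundaryValue G ψ) (hδε : δ < ε) {K : Set (RSpace n)} (hK : IsCompact K)
    (hKX : K ⊆ X) {φ : RSpace n → ℂ} (hφ : ContDiff ℝ ∞ φ) (hφK : tsupport φ ⊆ K) :
    ∃ C, ∀ t : Ioc (0 : ℝ) δ, ‖∫ x, φ x • G t x‖ ≤ C := by
  have hφc : HasCompactSupport φ := hK.of_isClosed_subset (isClosed_tsupport φ) hφK
  have hB := banach_steinhaus (g := fun t : Ioc (0 : ℝ) δ => innerSL ℂ (∫ x, φ x • G t x)) ?_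
  · obtain ⟨C, hC⟩ := hB
    exact ⟨C, fun t => by simpa using hC t⟩
  intro h
  have hlim := (hψ ⟨φ, hφ, hφc, hφK.trans hKX⟩ h).norm
  have hev := hlim.eventually (eventually_lt_nhds (lt_add_one _))
  obtain ⟨η, hη, hηb⟩ := (mem_nhdsGT_iff_exists_Ioo_subset).1 hev
  have hc : IsCompact (Icc η δ ×ˢ K) := isCompact_Icc.prod hK
  obtain ⟨B, hB⟩ := hc.exists_bound_of_continuousOn (hG.mono (prod_mono
    (fun t ht => ⟨lt_of_lt_of_le hη ht.1, ht.2.trans_lt hδε⟩) hKX))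
  refine ⟨max (‖inner ℂ h (ψ.toLinearMap ⟨φ, hφ, hφc, hφK.trans hKX⟩)‖ + 1)
    ((∫ x, ‖φ x‖ * B) * ‖h‖), fun t => ?_⟩
  rw [innerSL_apply_apply, norm_inner_symm]
  rcases lt_or_ge (t : ℝ) η with ht | ht
  · exact (le_of_lt (hηb ⟨t.2.1, ht⟩)).trans (le_max_left _ _)
  · refine le_trans ?_ (le_max_right _ _)
    refine (norm_inner_le_norm _ _).trans ?_
    rw [mul_comm]
    gcongr
    refine norm_integral_le_of_norm_le
      ((hφ.continuous.norm.integrable_of_hasCompactSupport hφc.norm).mul_const B)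
      (Eventually.of_forall fun x => ?_)
    rw [norm_smul]
    by_cases hx : x ∈ K
    · gcongr
      exact hB (t, x) ⟨⟨ht, t.2.2⟩, hx⟩
    · simp [image_eq_zero_of_notMem_tsupport fun h => hx (hφK h)]

/-- Near `t = 0` a family with a boundary value consists of distributions of uniformly bounded
order on compact sets. -/
theorem HasBoundaryValue.exists_uniform_order [CompleteSpace H] {X : Opens (RSpace n)}
    {ψ : HilbertDistribution X H} {ε δ : ℝ} {G : ℝ → RSpace n → H} (hψ : HasBoundaryValue G ψ)
    (hG : ContinuousOn (fun p : ℝ × RSpace n => G p.1 p.2) (Ioo 0 ε ×ˢ (X : Set (RSpace n))))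
    (hδε : δ < ε) {K : Set (RSpace n)} (hK : IsCompact K) (hKX : K ⊆ X) :
    ∃ (m : ℕ) (C : ℝ), 0 < C ∧ ∀ t ∈ Ioc 0 δ, ∀ (φ : RSpace n → ℂ) (M : ℝ), ContDiff ℝ ∞ φ →
      tsupport φ ⊆ K → 0 ≤ M → (∀ j ≤ m, ∀ x ∈ K, ‖iteratedFDeriv ℝ j φ x‖ ≤ M) →
      ‖∫ x, φ x • G t x‖ ≤ C * M := by
  obtain ⟨m, C, hC, h⟩ := exists_uniform_order_of_pointwise_bounded hK
    (fun (t : Ioc (0 : ℝ) δ) x => G t x)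
    (fun t => hG.comp (by fun_prop : ContinuousOn (fun x : RSpace n => ((t : ℝ), x)) K)
      fun x hx => ⟨⟨t.2.1, t.2.2.trans_lt hδε⟩, hKX hx⟩)
    fun φ hφ hφK => pointwise_bounded_of_hasBoundaryValue hG hψ hδε hK hKX hφ hφK
  exact ⟨m, C, hC, fun t ht φ M => h ⟨t, ht⟩ φ M⟩

end UniformBound

/-! ### The evolution equation tested against functions of `x`. -/

section Pairing

variable {n : ℕ} {H : Type*} [NormedAddCommGroup H] [InnerProductSpace ℂ H]

/-- Differentiation under the integral replaces `∂ₜG` by `i ∂ᵥG`; integration by parts then moves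
`∂ᵥ` onto `φ`. -/
theorem hasDerivAt_integral_smul_of_deriv_eq [CompleteSpace H] {X : Opens (RSpace n)} {ε : ℝ}
    {G : ℝ → RSpace n → H} {v : RSpace n}
    (hG : ContDiffOn ℝ ∞ (fun p : ℝ × RSpace n => G p.1 p.2) (Ioo 0 ε ×ˢ (X : Set (RSpace n))))
    (hGv : ∀ t ∈ Ioo 0 ε, ∀ x ∈ X,
      deriv (fun s => G s x) t = Complex.I • lineDeriv ℝ (G t) x v)
    {K : Set (RSpace n)} (hK : IsCompact K) (hKX : K ⊆ X) {φ φ' : RSpace n → ℂ}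
    (hφ : Continuous φ) (hφ' : Continuous φ') (hφK : tsupport φ ⊆ K) (hφK' : tsupport φ' ⊆ K)
    (hφv : ∀ x, HasLineDerivAt ℝ φ (φ' x) x v) {t : ℝ} (ht : t ∈ Ioo 0 ε) :
    HasDerivAt (fun s => ∫ x, φ x • G s x) (-(Complex.I • ∫ x, φ' x • G t x)) t := by
  have hφc : HasCompactSupport φ := hK.of_isClosed_subset (isClosed_tsupport φ) hφK
  set S : Set (ℝ × RSpace n) := Ioo 0 ε ×ˢ (X : Set (RSpace n)) with hS
  have hSo : IsOpen S := isOpen_Ioo.prod X.isOpen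
  let D : ℝ × RSpace n → (ℝ × RSpace n →L[ℝ] H) := fderiv ℝ fun p : ℝ × RSpace n => G p.1 p.2
  have hD : ∀ s ∈ Ioo 0 ε, ∀ x ∈ X,
      HasFDerivAt (fun p : ℝ × RSpace n => G p.1 p.2) (D (s, x)) (s, x) := fun s hs x hx =>
    ((hG.contDiffAt (hSo.mem_nhds ⟨hs, hx⟩)).differentiableAt (by simp)).hasFDerivAt
  have hDt : ∀ s ∈ Ioo 0 ε, ∀ x ∈ X, HasDerivAt (fun s => G s x) (D (s, x) (1, 0)) s :=
    fun s hs x hx => HasFDerivAt.comp_hasDerivAt (f := fun s : ℝ => (s, x)) s (hD s hs x hx)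
      ((hasDerivAt_id s).prodMk (hasDerivAt_const s x))
  have hDv : ∀ s ∈ Ioo 0 ε, ∀ x ∈ X, HasLineDerivAt ℝ (G s) (D (s, x) (0, v)) x v := by
    intro s hs x hx
    have h1 : HasFDerivAt (fun y : RSpace n => (s, y))
        ((0 : RSpace n →L[ℝ] ℝ).prod (ContinuousLinearMap.id ℝ _)) x :=
      (hasFDerivAt_const s x).prodMk (hasFDerivAt_id x)
    exact (HasFDerivAt.comp x (hD s hs x hx) h1).hasLineDerivAt v
  have hDI : ∀ s ∈ Ioo 0 ε, ∀ x ∈ X, D (s, x) (1, 0) = Complex.I • D (s, x) (0, v) := by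
    intro s hs x hx
    rw [← (hDt s hs x hx).deriv, hGv s hs x hx, (hDv s hs x hx).lineDeriv]
  have hDc : ContinuousOn D S := hG.continuousOn_fderiv_of_isOpen hSo (by simp)
  have hDw : ∀ w, ContinuousOn (fun p => D p w) S := fun w => hDc.clm_apply continuousOn_const
  have hslice : ∀ s ∈ Ioo 0 ε, ∀ w, ContinuousOn (fun x => D (s, x) w) K := fun s hs w =>
    (hDw w).comp (by fun_prop : ContinuousOn (fun x : RSpace n => (s, x)) K)
      fun x hx => ⟨hs, hKX hx⟩
  have hGs : ∀ s ∈ Ioo 0 ε, ContinuousOn (G s) K := fun s hs =>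
    hG.continuousOn.comp (by fun_prop : ContinuousOn (fun x : RSpace n => (s, x)) K)
      fun x hx => ⟨hs, hKX hx⟩
  obtain ⟨η, hη, hηs⟩ := Metric.nhds_basis_closedBall.mem_iff.1 (isOpen_Ioo.mem_nhds ht)
  obtain ⟨B, hB⟩ := ((isCompact_closedBall t η).prod hK).exists_bound_of_continuousOn
    ((hDw (1, 0)).mono (prod_mono hηs hKX))
  have hzero : ∀ x, x ∉ K → φ x = 0 := fun x hx =>
    image_eq_zero_of_notMem_tsupport fun h => hx (hφK h)
  have key := hasDerivAt_integral_of_dominated_loc_of_deriv_le (μ := volume)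
    (F := fun s x => φ x • G s x) (F' := fun s x => φ x • D (s, x) (1, 0)) (x₀ := t)
    (s := Ioo 0 ε ∩ Metric.closedBall t η) (bound := fun x => ‖φ x‖ * B)
    (inter_mem (isOpen_Ioo.mem_nhds ht) (Metric.closedBall_mem_nhds t hη))
    (by
      filter_upwards [isOpen_Ioo.mem_nhds ht] with s hs
      exact (integrable_smul_of_tsupport_subset hK hφ hφK (hGs s hs)).aestronglyMeasurable)
    (integrable_smul_of_tsupport_subset hK hφ hφK (hGs t ht))
    (integrable_smul_of_tsupport_subset hK hφ hφK (hslice t ht _)).aestronglyMeasurable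
    (Eventually.of_forall fun x s hs => by
      rw [norm_smul]
      by_cases hx : x ∈ K
      · gcongr
        exact hB (s, x) ⟨hs.2, hx⟩
      · simp [hzero x hx])
    ((hφ.norm.integrable_of_hasCompactSupport hφc.norm).mul_const B)
    (Eventually.of_forall fun x s hs => by
      by_cases hx : x ∈ K
      · exact (hDt s hs.1 x (hKX hx)).const_smul (φ x)
      · simpa [hzero x hx] using hasDerivAt_const s (0 : H))
  refine key.2.congr_deriv ?_
  have hparts := integral_bilinear_hasLineDerivAt_right_eq_neg_left_of_integrable (μ := volume)
    (B := ContinuousLinearMap.lsmul ℝ ℂ) (f := φ) (f' := φ') (g := G t)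
    (g' := fun x => D (t, x) (0, v)) (v := v)
    (integrable_smul_of_tsupport_subset hK hφ' hφK' (hGs t ht))
    (integrable_smul_of_tsupport_subset hK hφ hφK (hslice t ht _))
    (integrable_smul_of_tsupport_subset hK hφ hφK (hGs t ht))
    (fun x _ => hφv x) (fun x hx => hDv t ht x (hKX (hφK hx)))
  simp only [ContinuousLinearMap.lsmul_apply] at hparts
  rw [← smul_neg, ← hparts, ← integral_smul]
  congr 1
  funext x
  by_cases hx : x ∈ K
  · rw [hDI t ht x (hKX hx), smul_comm]
  · simp [hzero x hx]

end Pairing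

/-! ### Taylor expansion back to the boundary. -/

section Chain

variable {H : Type*} [NormedAddCommGroup H] [InnerProductSpace ℂ H]

/-- Weak lower semicontinuity of the norm, obtained by testing against `x` itself. -/
theorem norm_le_of_tendsto_inner {α : Type*} {l : Filter α} [l.NeBot] {f : α → H} {x : H} {R : ℝ}
    (hf : ∀ h : H, Tendsto (fun a => inner ℂ h (f a)) l (𝓝 (inner ℂ h x)))
    (hR : ∀ᶠ a in l, ‖f a‖ ≤ R) : ‖x‖ ≤ R := by
  have h1 : ‖inner ℂ x x‖ ≤ ‖x‖ * R := by
    refine le_of_tendsto (hf x).norm ?_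
    filter_upwards [hR] with a ha
    exact (norm_inner_le_norm _ _).trans (by gcongr)
  have h2 : ‖inner ℂ x x‖ = ‖x‖ ^ 2 := by
    rw [inner_self_eq_norm_sq_to_K]
    simp
  rw [h2] at h1
  by_contra! hlt
  have hR0 : 0 ≤ R := by
    obtain ⟨a, ha⟩ := hR.exists
    exact (norm_nonneg _).trans ha
  nlinarith

/-- The sum telescopes: differentiating the coefficient of `w (j + 1)` cancels the derivative of `w
j`. It is the Taylor polynomial at base point `t`, evaluated at `0`. -/
theorem hasDerivAt_taylor_sum {w : ℕ → ℝ → H} {s : ℝ} (M : ℕ)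
    (hw : ∀ j ≤ M, HasDerivAt (w j) (w (j + 1) s) s) :
    HasDerivAt (fun t => ∑ j ∈ Finset.range (M + 1), ((-t) ^ j / (j.factorial : ℝ)) • w j t)
      (((-s) ^ M / (M.factorial : ℝ)) • w (M + 1) s) s := by
  induction M with
  | zero => simpa using hw 0 le_rfl
  | succ M ih =>
    have h1 := ih fun j hj => hw j (by omega)
    have h2 : HasDerivAt (fun t : ℝ => (-t) ^ (M + 1) / ((M + 1).factorial : ℝ))
        (-((-s) ^ M / (M.factorial : ℝ))) s := by
      refine ((((hasDerivAt_id s).fun_neg).fun_pow (M + 1)).div_const _).congr_deriv ?_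
      rw [Nat.factorial_succ]
      push_cast
      simp only [id]
      field_simp
    have h3 := h1.fun_add (h2.fun_smul (hw (M + 1) le_rfl))
    simp only [Finset.sum_range_succ _ (M + 1)]
    refine h3.congr_deriv ?_
    module

/-- If `g j' = lam • g j - i • g (j + 1)` on `(0, δ]`, then the weak limit of `g 0` at `0` is bounded
in terms of bounds on `g 0, …, g (M + 1)`. -/
theorem norm_weakLimit_le_of_chain {g : ℕ → ℝ → H} {lam δ : ℝ} (hlam : 0 < lam) (hδ : 0 < δ)
    {M : ℕ} {b : ℕ → ℝ} (hb : ∀ j ≤ M + 1, ∀ t ∈ Ioc 0 δ, ‖g j t‖ ≤ b j)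
    (hg : ∀ j ≤ M, ∀ t ∈ Ioc 0 δ, HasDerivAt (g j) ((lam : ℂ) • g j t - Complex.I • g (j + 1) t) t)
    {x : H} (hx : ∀ h : H, Tendsto (fun t => inner ℂ h (g 0 t)) (𝓝[>] 0) (𝓝 (inner ℂ h x))) :
    ‖x‖ ≤ Real.exp (-(lam * δ)) * ∑ j ∈ Finset.range (M + 1), δ ^ j / (j.factorial : ℝ) * b j
      + b (M + 1) * (2 / lam) ^ (M + 1) := by
  let w : ℕ → ℝ → H := fun j t => Real.exp (-(lam * t)) • ((-Complex.I) ^ j • g j t)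
  have hwn : ∀ j t, ‖w j t‖ = Real.exp (-(lam * t)) * ‖g j t‖ := fun j t => by
    simp [w, norm_smul]
  have hw : ∀ j ≤ M, ∀ t ∈ Ioc 0 δ, HasDerivAt (w j) (w (j + 1) t) t := by
    intro j hj t ht
    have h1 : HasDerivAt (fun t => Real.exp (-(lam * t)))
        (Real.exp (-(lam * t)) * (-(lam * 1))) t :=
      (((hasDerivAt_id t).const_mul lam).fun_neg).exp
    have h2 := h1.fun_smul ((hg j hj t ht).fun_const_smul ((-Complex.I) ^ j))
    refine h2.congr_deriv ?_
    simp only [w, pow_succ, Complex.coe_smul]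
    module
  let W : ℝ → H := fun t => ∑ j ∈ Finset.range (M + 1), ((-t) ^ j / (j.factorial : ℝ)) • w j t
  have hW : ∀ t ∈ Ioc 0 δ, HasDerivAt W (((-t) ^ M / (M.factorial : ℝ)) • w (M + 1) t) t :=
    fun t ht => hasDerivAt_taylor_sum M fun j hj => hw j hj t ht
  have hb0 : ∀ j ≤ M + 1, 0 ≤ b j := fun j hj => (norm_nonneg _).trans (hb j hj δ ⟨hδ, le_rfl⟩)
  -- Half of the decay `e^{-λt}` pays for `t ^ M / M!`; the other half stays integrable.
  have hW' : ∀ t ∈ Ioc 0 δ, ‖((-t) ^ M / (M.factorial : ℝ)) • w (M + 1) t‖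
      ≤ (2 / lam) ^ M * b (M + 1) * Real.exp (-(lam / 2 * t)) := by
    intro t ht
    have h1 := Real.pow_div_factorial_le_exp (lam / 2 * t) (by have := ht.1; positivity) M
    rw [norm_smul, hwn, norm_div, norm_pow, norm_neg, Real.norm_of_nonneg ht.1.le,
      Real.norm_of_nonneg (by positivity : (0 : ℝ) ≤ (M.factorial : ℝ))]
    have h2 : t ^ M / (M.factorial : ℝ) ≤ (2 / lam) ^ M * Real.exp (lam / 2 * t) := by
      calc t ^ M / (M.factorial : ℝ)
          = (2 / lam) ^ M * ((lam / 2 * t) ^ M / (M.factorial : ℝ)) := by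
            rw [mul_div_assoc', ← mul_pow]
            congr 2
            field_simp
        _ ≤ _ := by gcongr
    calc _ ≤ ((2 / lam) ^ M * Real.exp (lam / 2 * t)) * (Real.exp (-(lam * t)) * b (M + 1)) := by
          gcongr
          exact hb _ le_rfl t ht
      _ = (2 / lam) ^ M * b (M + 1) * (Real.exp (lam / 2 * t) * Real.exp (-(lam * t))) := by ring
      _ = _ := by
          rw [← Real.exp_add]
          congr 2
          ring
  have hbM := hb0 (M + 1) le_rfl
  have hdiff : ∀ s ∈ Ioc 0 δ, ‖W δ - W s‖ ≤ b (M + 1) * (2 / lam) ^ (M + 1) := by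
    intro s hs
    -- An antiderivative of the majorant just found. The estimate on `[s, δ]` is uniform in `s`, so
    -- nothing is needed at `t = 0`, where only a weak limit exists.
    let Q : ℝ → ℝ := fun t => -((2 / lam) ^ (M + 1) * b (M + 1) * Real.exp (-(lam / 2 * t)))
    have hQ : ∀ t, HasDerivAt Q ((2 / lam) ^ M * b (M + 1) * Real.exp (-(lam / 2 * t))) t := by
      intro t
      refine (((((hasDerivAt_id t).const_mul (lam / 2)).fun_neg).exp).const_mul
        ((2 / lam) ^ (M + 1) * b (M + 1))).fun_neg.congr_deriv ?_
      simp only [id, pow_succ]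
      field_simp
    have hmv := image_norm_le_of_norm_deriv_right_le_deriv_boundary (f := fun t => W t - W s)
      (f' := fun t => ((-t) ^ M / (M.factorial : ℝ)) • w (M + 1) t) (a := s) (b := δ)
      (B := fun t => Q t - Q s)
      (fun t ht => ((hW t ⟨hs.1.trans_le ht.1, ht.2⟩).continuousAt.sub
        continuousAt_const).continuousWithinAt)
      (fun t ht => ((hW t ⟨hs.1.trans_le ht.1, ht.2.le⟩).sub_const (W s)).hasDerivWithinAt)
      (by simp) (fun t => (hQ t).sub_const (Q s))
      (fun t ht => hW' t ⟨hs.1.trans_le ht.1, ht.2.le⟩) (right_mem_Icc.2 hs.2)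
    refine hmv.trans ?_
    have e1 : Real.exp (-(lam / 2 * s)) ≤ 1 := Real.exp_le_one_iff.2 (by
      have := hs.1
      have : 0 < lam / 2 * s := by positivity
      linarith)
    have e2 := Real.exp_pos (-(lam / 2 * δ))
    have e3 : 0 ≤ (2 / lam) ^ (M + 1) * b (M + 1) := by positivity
    simp only [Q]
    nlinarith
  have hWδ : ‖W δ‖ ≤ Real.exp (-(lam * δ)) *
      ∑ j ∈ Finset.range (M + 1), δ ^ j / (j.factorial : ℝ) * b j := by
    rw [Finset.mul_sum]
    refine norm_sum_le_of_le _ fun j hj => ?_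
    rw [Finset.mem_range] at hj
    rw [norm_smul, hwn, norm_div, norm_pow, norm_neg, Real.norm_of_nonneg hδ.le,
      Real.norm_of_nonneg (by positivity : (0 : ℝ) ≤ (j.factorial : ℝ)), mul_left_comm]
    gcongr
    exact hb j (by omega) δ ⟨hδ, le_rfl⟩
  have hmem : ∀ᶠ s in 𝓝[>] (0 : ℝ), s ∈ Ioc 0 δ := Ioc_mem_nhdsGT hδ
  refine norm_le_of_tendsto_inner (l := 𝓝[>] (0 : ℝ)) (f := W) (fun h => ?_) ?_
  · have hexp : Tendsto (fun t : ℝ => Real.exp (-(lam * t))) (𝓝[>] 0) (𝓝 1) := by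
      have : Continuous fun t : ℝ => Real.exp (-(lam * t)) := by fun_prop
      simpa using (this.tendsto 0).mono_left nhdsWithin_le_nhds
    have h0 : Tendsto (fun t => inner ℂ h (w 0 t)) (𝓝[>] 0) (𝓝 (inner ℂ h x)) := by
      have h1 := ((Complex.continuous_ofReal.tendsto 1).comp hexp).mul (hx h)
      simp only [Complex.ofReal_one, one_mul] at h1
      refine h1.congr fun t => ?_
      simp only [w, pow_zero, one_smul, Function.comp]
      rw [← Complex.coe_smul, inner_smul_right]
    -- Since each `g j` is bounded, the factor `t ^ j` kills every term but `j = 0`, and `W` tends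
    -- weakly to `x`.
    have hj : ∀ j ∈ Finset.range (M + 1), j ≠ 0 → Tendsto
        (fun t => ((-t) ^ j / (j.factorial : ℝ)) • w j t) (𝓝[>] 0) (𝓝 0) := by
      intro j hj hj0
      rw [Finset.mem_range] at hj
      have hc : Tendsto (fun t : ℝ => t ^ j / (j.factorial : ℝ) *
          (Real.exp (-(lam * t)) * b j)) (𝓝[>] 0) (𝓝 0) := by
        have : Continuous fun t : ℝ => t ^ j / (j.factorial : ℝ) *
          (Real.exp (-(lam * t)) * b j) := by fun_prop
        simpa [hj0] using (this.tendsto 0).mono_left nhdsWithin_le_nhds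
      refine squeeze_zero_norm' ?_ hc
      filter_upwards [hmem] with t ht
      rw [norm_smul, hwn, norm_div, norm_pow, norm_neg, Real.norm_of_nonneg ht.1.le,
        Real.norm_of_nonneg (by positivity : (0 : ℝ) ≤ (j.factorial : ℝ))]
      have := ht.1
      gcongr
      exact hb j (by omega) t ht
    have hall : Tendsto (fun t => ∑ j ∈ Finset.range (M + 1),
        inner ℂ h (((-t) ^ j / (j.factorial : ℝ)) • w j t)) (𝓝[>] 0)
        (𝓝 (∑ j ∈ Finset.range (M + 1), if j = 0 then inner ℂ h x else 0)) := by
      refine tendsto_finsetSum _ fun j hjm => ?_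
      by_cases hj0 : j = 0
      · subst hj0
        simpa using h0
      · rw [if_neg hj0, ← inner_zero_right (𝕜 := ℂ) h]
        exact (tendsto_const_nhds).inner (hj j hjm hj0)
    simp only [W, inner_sum]
    rwa [Finset.sum_ite_eq' (Finset.range (M + 1)) 0, if_pos (by simp)] at hall
  · filter_upwards [hmem] with s hs
    have h1 : ‖W s‖ ≤ ‖W δ‖ + ‖W δ - W s‖ := by
      have := norm_sub_le (W δ) (W δ - W s)
      rwa [sub_sub_cancel] at this
    linarith [hdiff s hs]

end Chain

/-! ### From the Taylor estimate to factorial growth. -/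

/-- Here `y = |k|`, `lam = -⟨v, k⟩` and `q` is the norm of the transform at `k`. The order `m` costs
a factor `(1 + y) ^ m`, so `N + m` powers of `y` must be absorbed. -/
theorem exists_gevrey_bound (m : ℕ) {C₁ D c δ : ℝ} (hC₁ : 0 ≤ C₁) (hD : 0 < D) (hc : 0 < c)
    (hδ : 0 < δ) : ∃ C : ℝ, ∀ (N : ℕ) (y lam q : ℝ), 0 ≤ y → c * y ≤ lam →
      q ≤ C₁ * (1 + y) ^ m → (0 < y → q ≤ C₁ * (1 + y) ^ m *
        (Real.exp (-(lam * δ)) * Real.exp (δ * (D * (N + m + 2))) +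
          (D * (N + m + 2) * (2 / lam)) ^ (N + m + 1))) →
      y ^ N * q ≤ C * (C * (N + 1)) ^ N := by
  -- One constant for the three losses: `(c * δ)⁻¹` from the decay `e^{-λδ}`, `exp (δ * D)` from the
  -- sum of cutoff terms, `D * 2 / c` from the remainder.
  obtain ⟨E, hE1, hE2, hE3, hE4⟩ : ∃ E : ℝ, 1 ≤ E ∧ (c * δ)⁻¹ ≤ E ∧ Real.exp (δ * D) ≤ E ∧
      D * 2 / c ≤ E :=
    ⟨max (max 1 (c * δ)⁻¹) (max (Real.exp (δ * D)) (D * 2 / c)), by simp, by simp, by simp,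
      by simp⟩
  set F : ℝ := E ^ 2 * (m + 2) with hF
  have hF1 : 1 ≤ F := by
    have : (1 : ℝ) ≤ E ^ 2 := one_le_pow₀ hE1
    have : (0 : ℝ) ≤ m := by positivity
    nlinarith
  set C : ℝ := C₁ * 2 ^ (m + 1) * F ^ (m + 2) + 2 ^ (m + 2) * F with hC
  have hCa : C₁ * 2 ^ (m + 1) * F ^ (m + 2) ≤ C := le_add_of_nonneg_right (by positivity)
  have hCb : 2 ^ (m + 2) * F ≤ C := le_add_of_nonneg_left (by positivity)
  have hC1 : 1 ≤ C := by
    have : (1 : ℝ) ≤ 2 ^ (m + 2) := one_le_pow₀ (by norm_num)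
    nlinarith
  have hC2 : C₁ * 2 ^ m ≤ C := by
    refine le_trans ?_ hCa
    have h1 : (1 : ℝ) ≤ F ^ (m + 2) := one_le_pow₀ hF1
    have h2 : C₁ * (2 : ℝ) ^ m ≤ C₁ * 2 ^ (m + 1) := by gcongr <;> norm_num
    have h3 : 0 ≤ C₁ * (2 : ℝ) ^ (m + 1) := by positivity
    nlinarith
  refine ⟨C, fun N y lam q hy hlam hq hq' => ?_⟩
  rcases le_total y 1 with hy1 | hy1
  · have h1 : y ^ N ≤ 1 := pow_le_one₀ hy hy1
    have h2 : (1 : ℝ) ≤ (C * (N + 1)) ^ N := one_le_pow₀ (by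
      have : (0 : ℝ) ≤ N := by positivity
      nlinarith)
    have h3 : C₁ * (1 + y) ^ m ≤ C₁ * 2 ^ m := by
      gcongr
      linarith
    calc y ^ N * q ≤ y ^ N * (C₁ * 2 ^ m) := by gcongr; linarith
      _ ≤ 1 * (C₁ * 2 ^ m) := by gcongr
      _ ≤ C * 1 := by linarith
      _ ≤ _ := by gcongr
  have hy0 : 0 < y := by linarith
  have hlam0 : 0 < lam := lt_of_lt_of_le (by positivity) hlam
  have hX : ((N + m : ℕ) : ℝ) + 2 = N + m + 2 := by push_cast; ring
  set X : ℝ := N + m + 2 with hXdef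
  have hX1 : 1 ≤ X := by
    have : (0 : ℝ) ≤ N := by positivity
    have : (0 : ℝ) ≤ m := by positivity
    linarith
  have hE2X : 1 ≤ E ^ 2 * X := one_le_mul_of_one_le_of_one_le (one_le_pow₀ hE1) hX1
  have hEX : E * X ≤ E ^ 2 * X := by
    gcongr
    exact le_self_pow₀ hE1 two_ne_zero
  have t1 : y ^ (N + m) * (Real.exp (-(lam * δ)) * Real.exp (δ * (D * X)))
      ≤ (E ^ 2 * X) ^ (N + m + 2) := by
    have h1 : Real.exp (δ * (D * X)) ≤ E ^ (N + m + 2) := by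
      have : δ * (D * X) = ((N + m + 2 : ℕ) : ℝ) * (δ * D) := by
        rw [hXdef]; push_cast; ring
      rw [this, Real.exp_nat_mul]
      gcongr
    -- This is `y ^ p * exp (-(c * δ * y)) ≤ (c * δ)⁻¹ ^ p * p!` with `p = N + m`.
    have h2 : y ^ (N + m) * Real.exp (-(lam * δ)) ≤ (E * X) ^ (N + m) := by
      have h3 := Real.pow_div_factorial_le_exp (c * δ * y) (by positivity) (N + m)
      have h4 : Real.exp (c * δ * y) * Real.exp (-(lam * δ)) ≤ 1 := by
        rw [← Real.exp_add]
        refine Real.exp_le_one_iff.2 ?_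
        nlinarith
      have h5 : ((N + m).factorial : ℝ) ≤ X ^ (N + m) := by
        calc ((N + m).factorial : ℝ) ≤ ((N + m : ℕ) : ℝ) ^ (N + m) := by
              exact_mod_cast Nat.factorial_le_pow (N + m)
          _ ≤ _ := by gcongr; linarith
      have h6 : y ^ (N + m) ≤ (c * δ)⁻¹ ^ (N + m) * (N + m).factorial * Real.exp (c * δ * y) := by
        calc y ^ (N + m) = (c * δ)⁻¹ ^ (N + m) * (N + m).factorial *
              ((c * δ * y) ^ (N + m) / (N + m).factorial) := by
              rw [mul_assoc, mul_div_cancel₀ _ (by positivity), ← mul_pow]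
              congr 1
              field_simp
          _ ≤ _ := by gcongr
      calc _ ≤ (c * δ)⁻¹ ^ (N + m) * (N + m).factorial * Real.exp (c * δ * y) *
            Real.exp (-(lam * δ)) := by gcongr
        _ = (c * δ)⁻¹ ^ (N + m) * (N + m).factorial *
            (Real.exp (c * δ * y) * Real.exp (-(lam * δ))) := by ring
        _ ≤ E ^ (N + m) * X ^ (N + m) * 1 := by gcongr
        _ = _ := by rw [mul_one, mul_pow]
    calc _ = y ^ (N + m) * Real.exp (-(lam * δ)) * Real.exp (δ * (D * X)) := by ring
      _ ≤ (E * X) ^ (N + m) * E ^ (N + m + 2) := by gcongr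
      _ ≤ (E * X) ^ (N + m + 2) * E ^ (N + m + 2) := by
          refine mul_le_mul_of_nonneg_right (pow_le_pow_right₀ ?_ (by omega)) (by positivity)
          exact one_le_mul_of_one_le_of_one_le hE1 hX1
      _ = _ := by rw [← mul_pow]; ring
  have t2 : y ^ (N + m) * (D * X * (2 / lam)) ^ (N + m + 1) ≤ (E ^ 2 * X) ^ (N + m + 2) := by
    have h1 : D * X * (2 / lam) ≤ E * X / y := by
      calc D * X * (2 / lam) ≤ D * X * (2 / (c * y)) := by gcongr
        _ = (D * 2 / c) * X / y := by field_simp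
        _ ≤ _ := by gcongr
    calc _ ≤ y ^ (N + m) * (E * X / y) ^ (N + m + 1) := by gcongr
      _ = (E * X) ^ (N + m + 1) / y := by rw [div_pow, pow_succ y]; field_simp
      _ ≤ (E * X) ^ (N + m + 1) := div_le_self (by positivity) hy1
      _ ≤ (E ^ 2 * X) ^ (N + m + 1) := by gcongr
      _ ≤ _ := pow_le_pow_right₀ hE2X (by omega)
  have hXF : E ^ 2 * X ≤ F * (N + 1) := by
    rw [hF, mul_assoc]
    gcongr
    have : (0 : ℝ) ≤ N := by positivity
    have : (0 : ℝ) ≤ m := by positivity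
    rw [hXdef]
    nlinarith
  -- The surplus factor `(N + 1) ^ (m + 2)` is at most exponential in `N`, hence absorbed by the
  -- base `C`.
  have hN2 : ((N : ℝ) + 1) ≤ 2 ^ N := by exact_mod_cast Nat.lt_two_pow_self (n := N)
  calc y ^ N * q ≤ y ^ N * (C₁ * (1 + y) ^ m * (Real.exp (-(lam * δ)) *
        Real.exp (δ * (D * X)) + (D * X * (2 / lam)) ^ (N + m + 1))) := by
        gcongr
        exact hq' hy0
    _ ≤ y ^ N * (C₁ * (2 * y) ^ m * (Real.exp (-(lam * δ)) *
        Real.exp (δ * (D * X)) + (D * X * (2 / lam)) ^ (N + m + 1))) := by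
        gcongr
        linarith
    _ = C₁ * 2 ^ m * (y ^ (N + m) * (Real.exp (-(lam * δ)) * Real.exp (δ * (D * X))) +
        y ^ (N + m) * (D * X * (2 / lam)) ^ (N + m + 1)) := by ring
    _ ≤ C₁ * 2 ^ m * ((E ^ 2 * X) ^ (N + m + 2) + (E ^ 2 * X) ^ (N + m + 2)) := by gcongr
    _ = C₁ * 2 ^ (m + 1) * (E ^ 2 * X) ^ (N + m + 2) := by ring
    _ ≤ C₁ * 2 ^ (m + 1) * (F * (N + 1)) ^ (N + m + 2) := by gcongr
    _ = C₁ * 2 ^ (m + 1) * F ^ (m + 2) * ((F * (N + 1)) ^ N * (N + 1) ^ (m + 2)) := by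
        rw [add_assoc N m 2, pow_add (F * ((N : ℝ) + 1)), mul_pow F ((N : ℝ) + 1) (m + 2)]
        ring
    _ ≤ C₁ * 2 ^ (m + 1) * F ^ (m + 2) * ((F * (N + 1)) ^ N * (2 ^ N) ^ (m + 2)) := by gcongr
    _ = C₁ * 2 ^ (m + 1) * F ^ (m + 2) * (2 ^ (m + 2) * F * (N + 1)) ^ N := by
        rw [← pow_mul, mul_comm N, pow_mul, ← mul_pow, mul_comm (F * _)]
        simp only [mul_assoc]
    _ ≤ C * (C * (N + 1)) ^ N := by gcongr

/-! ### Analytic regularity where `⟨v, k₀⟩ < 0`. -/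

section Regularity

variable {n : ℕ} {H : Type*} [NormedAddCommGroup H] [InnerProductSpace ℂ H]

theorem contDiff_planeWave (k : RSpace n) : ContDiff ℝ ∞ (planeWave k : RSpace n → ℂ) :=
  (planeWave k).2

theorem planeWave_apply (k x : RSpace n) :
    (planeWave k : RSpace n → ℂ) x = Complex.exp (-Complex.I * ((inner ℝ k x : ℝ) : ℂ)) := rfl

theorem norm_iteratedFDeriv_planeWave_le (k x : RSpace n) (i : ℕ) :
    ‖iteratedFDeriv ℝ i (planeWave k : RSpace n → ℂ) x‖ ≤ ‖k‖ ^ i := by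
  let e : ℝ → ℂ := fun t => Complex.exp (-Complex.I * t)
  have he : ContDiff ℝ ∞ e := (contDiff_const.mul Complex.ofRealCLM.contDiff).cexp
  have hd : ∀ i, iteratedDeriv i e = fun t => (-Complex.I) ^ i * e t := by
    intro i
    induction i with
    | zero => simp
    | succ i ih =>
      rw [iteratedDeriv_succ, ih]
      funext t
      have h1 : HasDerivAt e (e t * (-Complex.I * 1)) t :=
        ((Complex.ofRealCLM.hasDerivAt (x := t)).const_mul (-Complex.I)).cexp
      rw [(h1.const_mul ((-Complex.I) ^ i)).deriv]
      ring
  have h := norm_iteratedFDeriv_comp_affine_le (innerSL ℝ k) he 0 x i (B := 1) fun t => by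
    rw [norm_iteratedFDeriv_eq_norm_iteratedDeriv, hd]
    simp only [norm_mul, norm_pow, norm_neg, Complex.norm_I, one_pow, one_mul, e]
    rw [Complex.norm_exp]
    simp
  simp only [sub_zero, one_mul, innerSL_apply_norm] at h
  exact h

theorem hasLineDerivAt_planeWave (k x v : RSpace n) :
    HasLineDerivAt ℝ (planeWave k : RSpace n → ℂ)
      ((planeWave k : RSpace n → ℂ) x * (-Complex.I * ((inner ℝ k v : ℝ) : ℂ))) x v := by
  have h1 : HasDerivAt (fun t : ℝ => inner ℝ k x + t * inner ℝ k v) (1 * inner ℝ k v) 0 :=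
    ((hasDerivAt_id (0 : ℝ)).mul_const _).const_add _
  have h2 := (h1.ofReal_comp.const_mul (-Complex.I)).cexp
  refine (HasDerivAt.congr_of_eventuallyEq h2 (Eventually.of_forall fun t => ?_)).congr_deriv ?_
  · simp only [planeWave_apply, inner_add_right, inner_smul_right]
  · simp [planeWave_apply]

/-- The product of a distribution with a compactly supported smooth function. -/
noncomputable def HilbertDistribution.localize {X : Opens (RSpace n)} (ψ : HilbertDistribution X H)
    (χ : RSpace n → ℂ) (hχ : ContDiff ℝ ∞ χ) (hχc : HasCompactSupport χ) (hχX : tsupport χ ⊆ X) :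
    SmoothFunctions n →ₗ[ℂ] H where
  toFun f := ψ.toLinearMap ⟨fun x => χ x * (f : RSpace n → ℂ) x, hχ.mul f.2, hχc.mul_right,
    (tsupport_mul_subset_left).trans hχX⟩
  map_add' f g := by
    rw [← map_add]
    congr 1
    ext x
    exact mul_add _ _ _
  map_smul' a f := by
    rw [RingHom.id_apply, ← map_smul]
    congr 1
    ext x
    exact mul_left_comm _ _ _

/-- The Taylor chain is applied to `ψ` cut off near `x₀`, with more derivatives available as `N`
grows. -/
theorem isAnalyticallyRegularAt_of_inner_neg [CompleteSpace H] {X : Opens (RSpace n)}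
    {ψ : HilbertDistribution X H} {ε : ℝ} {G : ℝ → RSpace n → H} {v : RSpace n} (hε : 0 < ε)
    (hG : ContDiffOn ℝ ∞ (fun p : ℝ × RSpace n => G p.1 p.2) (Ioo 0 ε ×ˢ (X : Set (RSpace n))))
    (hψ : HasBoundaryValue G ψ)
    (hGv : ∀ t ∈ Ioo 0 ε, ∀ x ∈ X,
      deriv (fun s => G s x) t = Complex.I • lineDeriv ℝ (G t) x v)
    {x₀ k₀ : RSpace n} (hx₀ : x₀ ∈ X) (hk₀ : (inner ℝ v k₀ : ℝ) < 0) :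
    IsAnalyticallyRegularAt ψ x₀ k₀ := by
  have hv : v ≠ 0 := by
    rintro rfl
    simp at hk₀
  have hk₀' : 0 < ‖k₀‖ := by
    refine norm_pos_iff.2 ?_
    rintro rfl
    simp at hk₀
  obtain ⟨K, hK, hKX, U, hU, hUX, hxU, A, D, hA, hD, hcut⟩ := exists_cutoffs_along X hx₀ hv
  choose χ hχ hχK hχ1 hχv hχb using hcut
  have hχc : ∀ N j, HasCompactSupport (χ N j) := fun N j =>
    hK.of_isClosed_subset (isClosed_tsupport _) (hχK N j)
  obtain ⟨m, C₀, hC₀, hord⟩ := hψ.exists_uniform_order hG.continuousOn (half_lt_self hε) hK hKX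
  set δ : ℝ := ε / 2 with hδdef
  have hδ : 0 < δ := half_pos hε
  have hδε : δ < ε := half_lt_self hε
  -- Half the normalised value at `k₀`, so that `k₀` lies strictly inside the open cone `⟨v, k⟩ <
  -- -c|k|`.
  set c : ℝ := -(inner ℝ v k₀ : ℝ) / (2 * ‖k₀‖) with hcdef
  have hc : 0 < c := div_pos (by linarith) (by positivity)
  -- Expansion to degree `M = N + m` uses derivatives of the cutoff up to order `N + m + 1`, hence
  -- this index and the factor `N + m + 2` in the bounds.
  let u : ℕ → (SmoothFunctions n →ₗ[ℂ] H) := fun N =>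
    ψ.localize (χ (N + m + 1) 0) (hχ _ _) (hχc _ _) ((hχK _ _).trans hKX)
  have huweak : ∀ N (f : SmoothFunctions n) (h : H), Tendsto (fun t => inner ℂ h
      (∫ x, (χ (N + m + 1) 0 x * (f : RSpace n → ℂ) x) • G t x)) (𝓝[>] 0)
      (𝓝 (inner ℂ h (u N f))) := fun N f h => hψ _ h
  have hubd : ∀ N (f : SmoothFunctions n) (M : ℝ), 0 ≤ M →
      (∀ j ≤ m, ∀ x ∈ K, ‖iteratedFDeriv ℝ j (f : RSpace n → ℂ) x‖ ≤ M) →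
      ‖u N f‖ ≤ C₀ * (2 ^ m * A m) * M := by
    intro N f M hM hf
    refine norm_le_of_tendsto_inner (huweak N f) ?_
    filter_upwards [Ioc_mem_nhdsGT hδ] with t ht
    rw [mul_assoc, mul_assoc (2 ^ m) (A m) M]
    have := hA m
    refine hord t ht _ _ ((hχ _ _).mul f.2) (tsupport_mul_subset_left.trans (hχK _ _))
      (by positivity) fun j hj x hx => ?_
    refine norm_iteratedFDeriv_mul_le_two_pow (hχ _ _) f.2 (fun i hi => ?_)
      (fun i hi => hf i hi x hx) hj
    simpa using hχb (N + m + 1) m 0 i x (Nat.zero_le _) hi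
  have hplane : ∀ (k x : RSpace n), ∀ i ≤ m,
      ‖iteratedFDeriv ℝ i (planeWave k : RSpace n → ℂ) x‖ ≤ (1 + ‖k‖) ^ m := by
    intro k x i hi
    calc _ ≤ ‖k‖ ^ i := norm_iteratedFDeriv_planeWave_le k x i
      _ ≤ (1 + ‖k‖) ^ i := by gcongr; linarith
      _ ≤ (1 + ‖k‖) ^ m := pow_le_pow_right₀ (by linarith [norm_nonneg k]) hi
  have hC₁ : 0 ≤ C₀ * (2 ^ m * A m) := by
    have := hA m
    positivity
  obtain ⟨C, hC⟩ := exists_gevrey_bound m hC₁ hD hc hδ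
  refine ⟨U, hU, hUX, hxU, {k | (inner ℝ v k : ℝ) < -(c * ‖k‖)}, ⟨?_, ?_⟩, ?_, u,
    ⟨K, hK, hKX, m, C₀ * (2 ^ m * A m) + 1, by positivity, fun N f M hM hf => ?_⟩,
    fun N φ hφ => ?_, C, fun N k hk => ?_⟩
  · exact isOpen_lt (by fun_prop) (by fun_prop)
  · intro a ha k hk
    rw [mem_ofPred_eq] at hk ⊢
    rw [inner_smul_right, norm_smul, Real.norm_of_nonneg ha.le]
    nlinarith
  · rw [mem_ofPred_eq, hcdef]
    have : -(inner ℝ v k₀ : ℝ) / (2 * ‖k₀‖) * ‖k₀‖ = -(inner ℝ v k₀ : ℝ) / 2 := by field_simp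
    rw [this]
    linarith
  · have := hubd N f M hM hf
    linarith
  · change ψ.toLinearMap _ = _
    congr 1
    ext x
    change χ (N + m + 1) 0 x * φ x = φ x
    by_cases hx : x ∈ tsupport φ
    · rw [hχ1 _ x (hφ hx), one_mul]
    · rw [image_eq_zero_of_notMem_tsupport hx, mul_zero]
  rw [mem_ofPred_eq] at hk
  refine hC N ‖k‖ (-(inner ℝ v k : ℝ)) _ (norm_nonneg _) (by linarith)
    (hubd N (planeWave k) _ (by positivity) fun j hj x _ => hplane k x j hj) fun hk0 => ?_
  set lam : ℝ := -(inner ℝ v k : ℝ) with hlamdef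
  have hlam : 0 < lam := by
    have : 0 < c * ‖k‖ := by positivity
    linarith
  set Y : ℝ := D * (N + m + 2) with hY
  have hYpos : 0 < Y := by positivity
  set B : ℝ := C₀ * (2 ^ m * A m) * (1 + ‖k‖) ^ m with hB
  have hB0 : 0 ≤ B := by positivity
  clear_value Y B
  let φ : ℕ → RSpace n → ℂ := fun j x =>
    χ (N + m + 1) j x * (planeWave k : RSpace n → ℂ) x
  have hφ : ∀ j, ContDiff ℝ ∞ (φ j) := fun j => (hχ _ _).mul (contDiff_planeWave k)
  have hφK : ∀ j, tsupport (φ j) ⊆ K := fun j => tsupport_mul_subset_left.trans (hχK _ _)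
  have hGs : ∀ t ∈ Ioo 0 ε, ContinuousOn (G t) K := fun t ht =>
    hG.continuousOn.comp (by fun_prop : ContinuousOn (fun x : RSpace n => (t, x)) K)
      fun x hx => ⟨ht, hKX hx⟩
  have hchain := norm_weakLimit_le_of_chain (g := fun j t => ∫ x, φ j x • G t x) hlam hδ
    (M := N + m) (b := fun j => B * Y ^ j) ?_ ?_ (huweak N (planeWave k))
  · refine hchain.trans ?_
    have hs : ∑ j ∈ Finset.range (N + m + 1), δ ^ j / (j.factorial : ℝ) * (B * Y ^ j)
        ≤ B * Real.exp (δ * Y) := by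
      calc _ = B * ∑ j ∈ Finset.range (N + m + 1), (δ * Y) ^ j / (j.factorial : ℝ) := by
            rw [Finset.mul_sum]
            refine Finset.sum_congr rfl fun j _ => ?_
            rw [mul_pow]
            ring
        _ ≤ _ := by
            gcongr
            exact Real.sum_le_exp_of_nonneg (by positivity) _
    calc _ ≤ Real.exp (-(lam * δ)) * (B * Real.exp (δ * Y)) +
          B * Y ^ (N + m + 1) * (2 / lam) ^ (N + m + 1) := by gcongr
      _ = _ := by
          rw [mul_pow]
          ring
  · intro j hj t ht
    have hA' := hA m
    refine (hord t ht (φ j) (2 ^ m * (A m * Y ^ j * (1 + ‖k‖) ^ m)) (hφ j) (hφK j)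
      (by positivity) fun i hi x _ => ?_).trans_eq (by rw [hB]; ring)
    refine norm_iteratedFDeriv_mul_le_two_pow (hχ _ _) (contDiff_planeWave k) (fun i hi => ?_)
      (fun i hi => hplane k x i hi) hi
    refine (hχb (N + m + 1) m j i x hj hi).trans_eq ?_
    rw [hY]
    push_cast
    ring
  · intro j hj t ht
    have ht' : t ∈ Ioo 0 ε := ⟨ht.1, ht.2.trans_lt hδε⟩
    -- Along `v` the plane wave has logarithmic derivative `-i⟨k, v⟩ = i * lam`; multiplied by the
    -- `-i` of the pairing formula, it yields `lam`.
    have hd := hasDerivAt_integral_smul_of_deriv_eq hG hGv hK hKX (φ := φ j)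
      (φ' := fun x => φ (j + 1) x + (Complex.I * lam) * φ j x) (hφ j).continuous
      ((hφ (j + 1)).continuous.add (continuous_const.mul (hφ j).continuous)) (hφK j)
      (closure_minimal (fun x hx => by
        by_contra hxK
        refine hx ?_
        have hz : ∀ j, φ j x = 0 := fun j =>
          image_eq_zero_of_notMem_tsupport fun h => hxK (hφK j h)
        simp [hz]) hK.isClosed)
      (fun x => by
        refine (HasDerivAt.fun_mul (hχv (N + m + 1) j x)
          (hasLineDerivAt_planeWave k x v)).congr_deriv ?_
        simp only [φ, zero_smul, add_zero, hlamdef, real_inner_comm v k, Complex.ofReal_neg]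
        ring) ht'
    refine hd.congr_deriv ?_
    have e : ∫ x, (φ (j + 1) x + (Complex.I * lam) * φ j x) • G t x
        = (∫ x, φ (j + 1) x • G t x) + (Complex.I * lam) • ∫ x, φ j x • G t x := by
      have hi : ∀ j, Integrable fun x => φ j x • G t x := fun j =>
        integrable_smul_of_tsupport_subset hK (hφ j).continuous (hφK j) (hGs t ht')
      rw [← integral_smul, ← integral_add (hi _) ((hi j).fun_smul (Complex.I * (lam : ℂ)))]
      simp only [add_smul, mul_smul]
    rw [e, smul_add, smul_smul, ← mul_assoc, Complex.I_mul_I, neg_one_mul, neg_smul]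
    abel

end Regularity

/-! ### Analytic functions on tubes. -/

section BoundaryValues

variable {n : ℕ} {H : Type*} [NormedAddCommGroup H] [InnerProductSpace ℂ H]

/-- The inclusion of `ℝⁿ` into `ℂⁿ`. -/
noncomputable def realInclusion (n : ℕ) : RSpace n →L[ℝ] EuclideanSpace ℂ (Fin n) :=
  LinearMap.toContinuousLinearMap
    { toFun := fun x => WithLp.toLp 2 fun j => ((x j : ℝ) : ℂ)
      map_add' := fun x y => by ext j; simp
      map_smul' := fun a x => by ext j; simp }

theorem complexPoint_smul_eq (x v : RSpace n) (t : ℝ) :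
    complexPoint x (t • v) = realInclusion n x + t • (Complex.I • realInclusion n v) := by
  ext j
  apply Complex.ext <;> simp [complexPoint, realInclusion]

theorem complexPoint_mem_tubeSet {X W : Set (RSpace n)} {x y : RSpace n} (hx : x ∈ X)
    (hy : y ∈ W) : complexPoint x y ∈ tubeSet X W :=
  ⟨x, hx, y, hy, rfl⟩

theorem contDiffOn_comp_complexPoint [CompleteSpace H] {X W : Set (RSpace n)} {G : EuclideanSpace ℂ (Fin n) → H}
    (hG : AnalyticOnNhd ℂ G (tubeSet X W)) {v : RSpace n} {S : Set ℝ}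
    (hS : ∀ t ∈ S, t • v ∈ W) :
    ContDiffOn ℝ ∞ (fun p : ℝ × RSpace n => G (complexPoint p.2 (p.1 • v))) (S ×ˢ X) := by
  rintro ⟨t, x⟩ ⟨ht, hx⟩
  have h1 : ContDiffAt ℝ ∞ G (complexPoint x (t • v)) :=
    (hG _ (complexPoint_mem_tubeSet hx (hS t ht))).contDiffAt.restrict_scalars ℝ
  have h2 : ContDiff ℝ ∞ fun p : ℝ × RSpace n => complexPoint p.2 (p.1 • v) := by
    simp only [complexPoint_smul_eq]
    exact ((realInclusion n).contDiff.comp contDiff_snd).add (contDiff_fst.smul contDiff_const)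
  exact (ContDiffAt.comp (t, x) h1 h2.contDiffAt).contDiffWithinAt

/-- Complex linearity of the derivative: moving `t` displaces the point along `iv`, moving `x`
displaces it along `v`. -/
theorem deriv_comp_complexPoint {X W : Set (RSpace n)} {G : EuclideanSpace ℂ (Fin n) → H}
    (hG : AnalyticOnNhd ℂ G (tubeSet X W)) {v x : RSpace n} {t : ℝ} (ht : t • v ∈ W)
    (hx : x ∈ X) :
    deriv (fun s : ℝ => G (complexPoint x (s • v))) t
      = Complex.I • lineDeriv ℝ (fun y => G (complexPoint y (t • v))) x v := by
  have hd := ((hG _ (complexPoint_mem_tubeSet hx ht)).differentiableAt.hasFDerivAt).restrictScalars ℝ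
  set A := fderiv ℂ G (complexPoint x (t • v))
  have h1 : HasDerivAt (fun s : ℝ => complexPoint x (s • v)) (Complex.I • realInclusion n v) t := by
    simp only [complexPoint_smul_eq]
    simpa using ((hasDerivAt_id t).smul_const (Complex.I • realInclusion n v)).const_add
      (realInclusion n x)
  have h2 : HasLineDerivAt ℝ (fun y => complexPoint y (t • v)) (realInclusion n v) x v := by
    have : HasFDerivAt (fun y => complexPoint y (t • v)) (realInclusion n) x := by
      simp only [complexPoint_smul_eq]
      exact (realInclusion n).hasFDerivAt.add_const _
    exact this.hasLineDerivAt v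
  have h3 : HasDerivAt (fun s : ℝ => G (complexPoint x (s • v)))
      (A (Complex.I • realInclusion n v)) t := by
    have := hd.comp_hasDerivAt t h1
    exact this
  have h4 : HasLineDerivAt ℝ (fun y => G (complexPoint y (t • v))) (A (realInclusion n v)) x v := by
    have hd' : HasFDerivAt G (A.restrictScalars ℝ) (complexPoint (x + (0 : ℝ) • v) (t • v)) := by
      simpa using hd
    have := hd'.comp_hasDerivAt 0 h2
    exact this
  rw [h3.deriv, h4.lineDeriv, map_smul]

end BoundaryValues

theorem theorem2p1 {n : ℕ} {H : Type*} [NormedAddCommGroup H] [InnerProductSpace ℂ H]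
    [CompleteSpace H] (X : Opens (RSpace n)) (ψ : HilbertDistribution X H) :
    -- boundary values of solutions of `∂ₜ G = i ∂_{x₁} G`
    (∀ (hn : 0 < n) (ε : ℝ) (G : ℝ → RSpace n → H), 0 < ε →
      ContDiffOn ℝ ∞ (fun p : ℝ × RSpace n => G p.1 p.2) (Ioo 0 ε ×ˢ (X : Set (RSpace n))) →
      HasBoundaryValue G ψ →
      (∀ t ∈ Ioo 0 ε, ∀ x ∈ X,
        deriv (fun s => G s x) t =
          Complex.I • lineDeriv ℝ (G t) x (EuclideanSpace.single (⟨0, hn⟩ : Fin n) (1 : ℝ))) →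
      analyticWF ψ ⊆ {p | p.1 ∈ X ∧ p.2 ≠ 0 ∧ 0 ≤ p.2 ⟨0, hn⟩}) ∧
    -- boundary values of functions that are analytic in `X × (V ∩ Z)`
    (∀ (V Z : Set (RSpace n)) (G : EuclideanSpace ℂ (Fin n) → H),
      IsOpenCone V → 0 ∉ V → IsOpen Z → 0 ∈ Z →
      AnalyticOnNhd ℂ G (tubeSet X (V ∩ Z)) →
      (∀ v ∈ V, HasBoundaryValue (fun t x => G (complexPoint x (t • v))) ψ) →
      analyticWF ψ ⊆ (X : Set (RSpace n)) ×ˢ dualCone V) := by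
  refine ⟨fun hn ε G hε hG hψ hGv => ?_, fun V Z G hV _ hZ hZ0 hG hψ => ?_⟩
  · rintro ⟨x₀, k₀⟩ ⟨hx₀, hk₀, hreg⟩
    refine ⟨hx₀, hk₀, ?_⟩
    by_contra! hneg
    refine hreg (isAnalyticallyRegularAt_of_inner_neg hε hG hψ hGv hx₀ ?_)
    rw [EuclideanSpace.inner_single_left]
    simpa using hneg
  · rintro ⟨x₀, k₀⟩ ⟨hx₀, -, hreg⟩
    refine ⟨hx₀, fun v hv => ?_⟩
    by_contra! hneg
    -- Only the segment `t • v` with small `t` has to lie in `V ∩ Z`; the interval length may depend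
    -- on `v`.
    have hnhds : (fun t : ℝ => t • v) ⁻¹' Z ∈ 𝓝 (0 : ℝ) := by
      have hc : Continuous fun t : ℝ => t • v := by fun_prop
      exact hc.continuousAt.preimage_mem_nhds (hZ.mem_nhds (by simpa using hZ0))
    obtain ⟨ε, hε, hεZ⟩ := Metric.mem_nhds_iff.1 hnhds
    have hmem : ∀ t ∈ Ioo 0 ε, t • v ∈ V ∩ Z := fun t ht => ⟨hV.2 t ht.1 v hv, hεZ (by
      rw [Metric.mem_ball, Real.dist_0_eq_abs, abs_of_pos ht.1]
      exact ht.2)⟩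
    exact hreg (isAnalyticallyRegularAt_of_inner_neg (G := fun t x => G (complexPoint x (t • v)))
      hε (contDiffOn_comp_complexPoint hG hmem) (hψ v hv)
      (fun t ht x hx => deriv_comp_complexPoint hG (hmem t ht) hx) hx₀ hneg)
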